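/- Let $q=p^m\ge 5$ with $p$ prime and $3\mid q-1$, and put $n=\frac{q-1}{3}$. Let $\Gamma(3,q)$ be the directed graph with vertex set the field $\mathbb F_q$ of $q$ elements, with an edge from $u$ to $v$ if and only if $v-u=x^3$ for some $x\in\mathbb F_q^*$. Its spectrum is the multiset of complex eigenvalues of its adjacency matrix, written $\{[\lambda_0]^{m_0},\dots,[\lambda_t]^{m_t}\}$, where the $\lambda_i$ are pairwise different and $m_i$ is the multiplicity of $\lambda_i$. Then $\Gamma(3,q)$ is undirected and connected, and its spectrum is as follows. (a) If $p\equiv 1\pmod 3$ and $3\mid m$, then $$\mathrm{Spec}(\Gamma(3,q))=\Big\{[n]^1,\ \Big[\tfrac{a\sqrt[3]{q}-1}{3}\Big]^n,\ \Big[\tfrac{-\frac12(a+9b)\sqrt[3]{q}-1}{3}\Big]^n,\ \Big[\tfrac{-\frac12(a-9b)\sqrt[3]{q}-1}{3}\Big]^n\Big\},$$ where $a,b$ are the integers, which exist and are uniquely determined ($b$ up to sign), with $4\sqrt[3]{q}=a^2+27b^2$, $a\equiv 1\pmod 3$ and $(a,p)=1$. (b) If $p\equiv 1\pmod 3$ and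 $3\nmid m$, then $\mathrm{Spec}(\Gamma(3,q))=\{[n]^1,[x_0]^n,[x_1]^n,[x_2]^n\}$ with $$x_j=-\tfrac13\Big(1+\omega^jW+\frac{q}{\omega^jW}\Big),\quad j\in\{0,1,2\},\qquad \omega=e^{2\pi i/3},\qquad W=\sqrt[3]{q}\,\sqrt[3]{\tfrac12\big(-a+\sqrt{-27}\,b\big)},$$ where $a,b$ are the integers, which exist and are uniquely determined ($b$ up to sign), with $4q=a^2+27b^2$, $a\equiv 1\pmod 3$ and $(a,p)=1$. Here each square or cube root may be any complex one, and for every choice the numbers $\omega^jW$ are non-real. (c) If $p\equiv 2\pmod 3$ and $m$ is even, then $$\mathrm{Spec}(\Gamma(3,q))=\begin{cases}\Big\{[n]^1,\ \Big[\tfrac{\sqrt q-1}{3}\Big]^{2n},\ \Big[\tfrac{-2\sqrt q-1}{3}\Big]^{n}\Big\}&\text{if } m\equiv 0\pmod 4,\\[2mm] \Big\{[n]^1,\ \Big[\tfrac{2\sqrt q-1}{3}\Big]^{n},\ \Big[\tfrac{-\sqrt q-1}{3}\Big]^{2n}\Big\}&\text{if } m\equiv 2\pmod 4.\end{cases}$$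 In cases (a) and (c) all eigenvalues are integers; in case (b) all eigenvalues other than $n$ are real and irrational. -/

import Mathlib

/-- The generalized Paley graph `Γ(k, q)` over a field `F` with `q` elements, as a directed graph:
there is an edge from `u` to `v` iff `v - u = x ^ k` for some nonzero `x`. -/
def gpGraph (k : ℕ) (F : Type*) [Field F] : Digraph F where
  Adj u v := ∃ x : F, x ≠ 0 ∧ v - u = x ^ k

namespace Digraph

/-- The digraph is undirected: every edge can be reversed. -/
def IsUndirected {V : Type*} (G : Digraph V) : Prop :=
  ∀ u v : V, G.Adj u v → G.Adj v u

/-- The digraph is (strongly) connected: it has a vertex, and there is a directed path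
from every vertex to every vertex. -/
def IsStronglyConnected {V : Type*} (G : Digraph V) : Prop :=
  Nonempty V ∧ ∀ u v : V, Relation.ReflTransGen G.Adj u v

open Classical in
/-- The adjacency matrix over `ℂ`. -/
noncomputable def adjMatrix {V : Type*} (G : Digraph V) : Matrix V V ℂ :=
  Matrix.of fun u v => if G.Adj u v then 1 else 0

open Classical in
/-- The spectrum: the multiset of the complex eigenvalues of the adjacency matrix,
with their multiplicities. -/
noncomputable def spec {V : Type*} [Fintype V] (G : Digraph V) : Multiset ℂ :=
  G.adjMatrix.charpoly.roots

/-- `Spec(G) = {[l₀]^{m₀}, …, [lₜ]^{mₜ}}` for the list `L = [(l₀, m₀), …, (lₜ, mₜ)]`: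
the `lᵢ` are pairwise different, and they are the eigenvalues of `G`, with multiplicities `mᵢ`. -/
def HasSpec {V : Type*} [Fintype V] (G : Digraph V) (L : List (ℂ × ℕ)) : Prop :=
  (L.map Prod.fst).Nodup ∧ G.spec = (L.map fun e => Multiset.replicate e.2 e.1).sum

end Digraph

/-- `4 N = a² + 27 b²` with `a ≡ 1 (mod 3)` and `a` prime to `p`. The number `N` is real, so that
it may be written as a cube root. -/
def IsRep27 (p : ℕ) (N : ℝ) (a b : ℤ) : Prop :=
  4 * N = (a : ℝ) ^ 2 + 27 * (b : ℝ) ^ 2 ∧ a ≡ 1 [ZMOD 3] ∧ IsCoprime a (p : ℤ)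

/-- There are integers `a`, `b` as in `IsRep27`; `a` is unique, and `b` is unique up to sign. -/
def ExistsUniqueRep27 (p : ℕ) (N : ℝ) : Prop :=
  ∃ a b : ℤ, IsRep27 p N a b ∧
    ∀ a' b' : ℤ, IsRep27 p N a' b' → a' = a ∧ (b' = b ∨ b' = -b)

/-- The root `-(1 + ω ^ j W + q / (ω ^ j W)) / 3` of Cardano's formula, with `ω = exp (2 π i / 3)`. -/
noncomputable def cardanoRoot (q : ℕ) (W : ℂ) (j : ℕ) : ℂ :=
  -(1 / 3) * (1 + Complex.exp (2 * Real.pi * Complex.I / 3) ^ j * W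
    + (q : ℂ) / (Complex.exp (2 * Real.pi * Complex.I / 3) ^ j * W))

/-! The graph is the Cayley graph of the additive group of `F` on the set of nonzero cubes, so
additive characters diagonalise it: the eigenvalue at `a` is the sum of `ψ (a * s)` over nonzero
cubes `s`. For a cubic character `χ`, the indicator of these cubes is `(1 + χ + χ⁻¹) / 3`. At `a =
0` the sum is `n`; at `a ≠ 0` it is `(z + q / z - 1) / 3` with `z = χ⁻¹(a) G`, where `G` is the
Gauss sum of `χ`, because `G(χ) G(χ⁻¹) = χ(-1) q = q`. Each of the three values of `χ⁻¹` occurs `n`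
times, and the resulting multiset depends only on `G³`.

Now `G³ = q J` with `J = J(χ, χ)` an Eisenstein integer of norm `q`, congruent to `-1` modulo `3`.
Hence `2 J = A + √-27 B` with `4 q = A² + 27 B²` and `A ≡ 1 (mod 3)`. Replacing `√-27` by its
negative amounts to replacing `z` by `q / z`, which changes no eigenvalue.

If `p ≡ 1 (mod 3)`, reducing `J` modulo a prime above `p` gives a binomial coefficient up to sign,
nonzero by Lucas; thus `p ∤ A`, and the representation with this property is unique up to the sign
of `B`. When `3 ∣ m`, the number `(A + √-27 B) / 2` is itself the cube of `(a + √-27 b) / 2`. When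
`3 ∤ m`, the numbers `x = z + q / z` are the real roots of `x³ = q (3 x + A)`, and a comparison of
`p`-adic valuations excludes rational ones. If `p ≡ 2 (mod 3)`, Frobenius exchanges `χ` and `χ⁻¹`,
so `J` is real, `B = 0`, and the congruence modulo `3` fixes the sign in `A = ±2 √q`.

Connectedness: the vertices reachable from `0` form a subfield too large to be proper. -/

open Polynomial in
/-- The characteristic polynomial of the matrix `f (v - u)`, by diagonalisation with additive
characters. -/
theorem charpoly_of_sub_eq_prod {F : Type*} [Field F] [Fintype F] [DecidableEq F]
    {ψ : AddChar F ℂ} (hψ : ψ.IsPrimitive) (f : F → ℂ) :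
    (Matrix.of fun u v : F => f (v - u)).charpoly = ∏ a : F, (X - C (∑ s, f s * ψ (a * s))) := by
  have hq : (Fintype.card F : ℂ) ≠ 0 := by simp
  let P : Matrix F F ℂ := Matrix.of fun u a => ψ (a * u)
  let Q : Matrix F F ℂ := Matrix.of fun a u => (Fintype.card F : ℂ)⁻¹ * ψ (-(a * u))
  have hPQ : P * Q = 1 := by
    ext u v
    have : ∀ a : F, P u a * Q a v = (Fintype.card F : ℂ)⁻¹ * ψ (a * (u - v)) := by
      intro a
      simp only [P, Q, Matrix.of_apply]
      rw [mul_left_comm, ← AddChar.map_add_eq_mul]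
      congr 2; ring
    rw [Matrix.mul_apply, Finset.sum_congr rfl fun a _ => this a, ← Finset.mul_sum,
      AddChar.sum_mulShift _ hψ, Matrix.one_apply]
    by_cases h : u = v
    · simp [h]
    · simp [h, sub_eq_zero]
  let U : (Matrix F F ℂ)ˣ := ⟨P, Q, hPQ, mul_eq_one_comm.mp hPQ⟩
  have hM : (Matrix.of fun u v : F => f (v - u)) * P =
      P * Matrix.diagonal fun a => ∑ s, f s * ψ (a * s) := by
    ext u a
    rw [Matrix.mul_diagonal, Matrix.mul_apply, Finset.mul_sum,
      ← Equiv.sum_comp (Equiv.addRight u)]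
    refine Finset.sum_congr rfl fun s _ => ?_
    simp only [P, Matrix.of_apply, Equiv.coe_addRight, add_sub_cancel_right, mul_add,
      AddChar.map_add_eq_mul]
    ring
  have hM' : (Matrix.of fun u v : F => f (v - u)) =
      U.val * Matrix.diagonal (fun a => ∑ s, f s * ψ (a * s)) * U.val⁻¹ := by
    rw [← Matrix.coe_units_inv]
    change _ = P * _ * Q
    rw [← hM, Matrix.mul_assoc, hPQ, Matrix.mul_one]
  rw [hM', Matrix.charpoly_units_conj, Matrix.charpoly_diagonal]

/-! ### Cubic characters and their fibres -/

theorem MulChar.cubic_apply_pow {F : Type*} [Field F] {R : Type*} [CommRing R] {χ : MulChar F R}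
    (h3 : χ ^ 3 = 1) {a : F} (ha : a ≠ 0) : χ a ^ 3 = 1 := by
  rw [← MulChar.pow_apply' χ three_ne_zero, h3, MulChar.one_apply ha.isUnit]

/-- A cubic character detects the cubes. -/
theorem MulChar.cubic_apply_eq_one_iff {F : Type*} [Field F] [Fintype F] {R : Type*} [CommRing R]
    {χ : MulChar F R} (h3 : χ ^ 3 = 1) (h1 : χ ≠ 1) {a : F} (ha : a ≠ 0) :
    χ a = 1 ↔ ∃ x : F, x ≠ 0 ∧ a = x ^ 3 := by
  constructor
  · intro h
    obtain ⟨g, hg⟩ := IsCyclic.exists_monoid_generator (α := Fˣ)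
    have hg1 : χ g ≠ 1 := by
      intro hg'
      refine h1 ((MulChar.eq_iff (g := g) (fun x => ?_) χ 1).mpr
        (by rw [hg', MulChar.one_apply_coe]))
      obtain ⟨k, hk⟩ := hg x
      exact ⟨k, by simpa using hk⟩
    have hg3 : χ g ^ 3 = 1 := MulChar.cubic_apply_pow h3 g.ne_zero
    obtain ⟨k, hk⟩ := hg (Units.mk0 a ha)
    have hk' : a = (g : F) ^ k := by
      have := congrArg Units.val hk
      simpa using this.symm
    have hpow : χ g ^ (k % 3) = 1 := by
      rw [hk', map_pow, ← Nat.div_add_mod k 3, pow_add, pow_mul, hg3, one_pow, one_mul] at h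
      exact h
    have hk3 : k % 3 = 0 := by
      have hlt := Nat.mod_lt k (show 3 > 0 by norm_num)
      interval_cases hr : k % 3
      · rfl
      · exact absurd (by simpa using hpow) hg1
      · exact absurd (by rw [pow_succ, hpow, one_mul] at hg3; exact hg3) hg1
    refine ⟨(g : F) ^ (k / 3), pow_ne_zero _ g.ne_zero, ?_⟩
    rw [hk', ← pow_mul, Nat.div_mul_cancel (Nat.dvd_of_mod_eq_zero hk3)]
  · rintro ⟨x, hx, rfl⟩
    rw [map_pow, MulChar.cubic_apply_pow h3 hx]

/-- Since `t² = t⁻¹`, this is the geometric sum `1 + y + y²` at the cube root of unity `y = x / t`.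
-/
theorem one_add_mul_add_mul_of_cube_eq_one {x t : ℂ} (hx : x ^ 3 = 1) (ht : t ^ 3 = 1) :
    1 + t ^ 2 * x + t * x ^ 2 = if x = t then 3 else 0 := by
  split_ifs with h
  · subst h
    linear_combination 2 * hx
  · have h0 : t - x ≠ 0 := sub_ne_zero.mpr (Ne.symm h)
    have : (t - x) * (1 + t ^ 2 * x + t * x ^ 2) = 0 := by
      linear_combination x * ht - t * hx
    exact (mul_eq_zero.mp this).resolve_left h0

/-- Orthogonality on the group of cube roots of unity. The trivial character vanishes at `0`, which
accounts for the condition `a ≠ 0`. -/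
theorem MulChar.cubic_indicator {F : Type*} [Field F] {χ : MulChar F ℂ} (h3 : χ ^ 3 = 1)
    {t : ℂ} (ht : t ^ 3 = 1) (a : F) [Decidable (a ≠ 0 ∧ χ a = t)] :
    (1 : MulChar F ℂ) a + t ^ 2 * χ a + t * χ⁻¹ a = 3 * if a ≠ 0 ∧ χ a = t then 1 else 0 := by
  have hinv : χ⁻¹ = χ ^ 2 := by
    rw [inv_eq_iff_mul_eq_one, ← pow_succ', h3]
  rcases eq_or_ne a 0 with rfl | ha
  · simp
  · rw [MulChar.one_apply ha.isUnit, hinv, MulChar.pow_apply' χ two_ne_zero,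
      one_add_mul_add_mul_of_cube_eq_one (MulChar.cubic_apply_pow h3 ha) ht]
    by_cases h : χ a = t <;> simp [ha, h]

/-- The three nonzero fibres of a cubic character have the same number of elements. -/
theorem MulChar.card_cubic_fiber {F : Type*} [Field F] [Fintype F] [DecidableEq F]
    {χ : MulChar F ℂ} (h3 : χ ^ 3 = 1) (h1 : χ ≠ 1) {t : ℂ} (ht : t ^ 3 = 1) :
    ({a : F | a ≠ 0 ∧ χ a = t} : Finset F).card = (Fintype.card F - 1) / 3 := by
  have h : (3 * ({a : F | a ≠ 0 ∧ χ a = t} : Finset F).card : ℂ) =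
      (Fintype.card F - 1 : ℕ) := by
    rw [Finset.card_filter, Nat.cast_sum, Finset.mul_sum]
    have : ∀ a : F, (3 * ((if a ≠ 0 ∧ χ a = t then 1 else 0 : ℕ) : ℂ)) =
        (1 : MulChar F ℂ) a + t ^ 2 * χ a + t * χ⁻¹ a := by
      intro a
      rw [MulChar.cubic_indicator h3 ht a]
      split_ifs <;> simp
    rw [Finset.sum_congr rfl fun a _ => this a, Finset.sum_add_distrib, Finset.sum_add_distrib,
      ← Finset.mul_sum, ← Finset.mul_sum, MulChar.sum_eq_zero_of_ne_one h1,
      MulChar.sum_eq_zero_of_ne_one (inv_ne_one.mpr h1), MulChar.sum_one_eq_card_units,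
      Fintype.card_units]
    simp
  have h' : 3 * ({a : F | a ≠ 0 ∧ χ a = t} : Finset F).card = Fintype.card F - 1 := by
    exact_mod_cast h
  omega

/-! ### Cube roots of unity and the eigenvalues attached to `z` -/

/-- The standard primitive cube root of unity. -/
noncomputable def zeta3 : ℂ := Complex.exp (2 * Real.pi * Complex.I / 3)

theorem zeta3_isPrimitiveRoot : IsPrimitiveRoot zeta3 3 := by
  simpa [zeta3] using Complex.isPrimitiveRoot_exp 3 three_ne_zero

theorem zeta3_cube : zeta3 ^ 3 = 1 := zeta3_isPrimitiveRoot.pow_eq_one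

theorem zeta3_sq : zeta3 ^ 2 + zeta3 + 1 = 0 := by
  have h1 : zeta3 - 1 ≠ 0 := sub_ne_zero.mpr (zeta3_isPrimitiveRoot.ne_one (by norm_num))
  have : (zeta3 - 1) * (zeta3 ^ 2 + zeta3 + 1) = 0 := by linear_combination zeta3_cube
  exact (mul_eq_zero.mp this).resolve_left h1

theorem zeta3_ne_zero : zeta3 ≠ 0 := Complex.exp_ne_zero _

theorem cube_eq_cube_iff_zeta3 {x y : ℂ} (h : x ^ 3 = y ^ 3) :
    x = y ∨ x = zeta3 * y ∨ x = zeta3 ^ 2 * y := by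
  have : (x - y) * ((x - zeta3 * y) * (x - zeta3 ^ 2 * y)) = 0 := by
    linear_combination h + (-x ^ 2 * y + x * y ^ 2 * zeta3) * zeta3_sq + (-y ^ 3) * zeta3_cube
  simpa [sub_eq_zero] using this

/-- Collects the linear factors of the characteristic polynomial into three `n`-th powers, one for
each fibre of the character. -/
theorem MulChar.prod_cubic {F : Type*} [Field F] [Fintype F] [DecidableEq F]
    {χ : MulChar F ℂ} (h3 : χ ^ 3 = 1) (h1 : χ ≠ 1) {M : Type*} [CommMonoid M] (H : ℂ → M) :
    ∏ a ∈ Finset.univ.erase (0 : F), H (χ a) =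
      H 1 ^ ((Fintype.card F - 1) / 3) * H zeta3 ^ ((Fintype.card F - 1) / 3) *
        H (zeta3 ^ 2) ^ ((Fintype.card F - 1) / 3) := by
  have hmaps : ∀ a ∈ Finset.univ.erase (0 : F), χ a ∈ ({1, zeta3, zeta3 ^ 2} : Finset ℂ) := by
    intro a ha
    have := cube_eq_cube_iff_zeta3 (x := χ a) (y := 1)
      (by rw [MulChar.cubic_apply_pow h3 (Finset.ne_of_mem_erase ha), one_pow])
    simpa using this
  have hfib : ∀ t : ℂ, t ^ 3 = 1 → ∏ a ∈ Finset.univ.erase (0 : F) with χ a = t, H (χ a) =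
      H t ^ ((Fintype.card F - 1) / 3) := by
    intro t ht
    rw [Finset.prod_congr rfl fun a ha => congrArg H (Finset.mem_filter.mp ha).2,
      Finset.prod_const, ← MulChar.card_cubic_fiber h3 h1 ht]
    congr 2
    ext a
    simp
  rw [← Finset.prod_fiberwise_of_maps_to hmaps, Finset.prod_insert, Finset.prod_insert,
    Finset.prod_singleton, hfib 1 (one_pow 3), hfib _ zeta3_cube, hfib, mul_assoc]
  · rw [← pow_mul, mul_comm, pow_mul, zeta3_cube, one_pow]
  · intro h
    have h := Finset.mem_singleton.mp h
    have := zeta3_isPrimitiveRoot.pow_inj (i := 1) (j := 2) (by norm_num) (by norm_num)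
      (by rw [pow_one]; exact h)
    norm_num at this
  · intro h
    rw [Finset.mem_insert, Finset.mem_singleton] at h
    rcases h with h | h
    · exact zeta3_isPrimitiveRoot.ne_one (by norm_num) h.symm
    · exact zeta3_isPrimitiveRoot.pow_ne_one_of_pos_of_lt two_ne_zero (by norm_num) h.symm

/-- The eigenvalue `(z + q / z - 1) / 3`. -/
noncomputable def cubicEigenvalue (q : ℕ) (z : ℂ) : ℂ := (z + q / z - 1) / 3

/-- The nontrivial part of the spectrum, for a cube root `z` of the cube of the Gauss sum. -/
noncomputable def cubicEigenvalues (q n : ℕ) (z : ℂ) : Multiset ℂ :=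
  Multiset.replicate n (cubicEigenvalue q z) +
    Multiset.replicate n (cubicEigenvalue q (zeta3 * z)) +
    Multiset.replicate n (cubicEigenvalue q (zeta3 ^ 2 * z))

/-- Multiplying `z` by a cube root of unity permutes the three eigenvalues. Hence knowing the cube
of the Gauss sum suffices. -/
theorem cubicEigenvalues_congr (q n : ℕ) {z w : ℂ} (h : z ^ 3 = w ^ 3) :
    cubicEigenvalues q n z = cubicEigenvalues q n w := by
  rcases cube_eq_cube_iff_zeta3 h with rfl | rfl | rfl
  · rfl
  · have h3 : zeta3 ^ 2 * (zeta3 * w) = w := by linear_combination w * zeta3_cube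
    have h2 : zeta3 * (zeta3 * w) = zeta3 ^ 2 * w := by ring
    rw [cubicEigenvalues, cubicEigenvalues, h2, h3]
    abel
  · have h3 : zeta3 * (zeta3 ^ 2 * w) = w := by linear_combination w * zeta3_cube
    have h2 : zeta3 ^ 2 * (zeta3 ^ 2 * w) = zeta3 * w := by
      linear_combination zeta3 * w * zeta3_cube
    rw [cubicEigenvalues, cubicEigenvalues, h2, h3]
    abel

theorem cubicEigenvalue_div {q : ℕ} (hq : q ≠ 0) (z : ℂ) :
    cubicEigenvalue q (q / z) = cubicEigenvalue q z := by
  have : (q : ℂ) ≠ 0 := Nat.cast_ne_zero.mpr hq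
  rw [cubicEigenvalue, cubicEigenvalue, div_div_cancel₀ this, add_comm (q / z)]

/-- The map `z ↦ q / z` fixes the first eigenvalue and swaps the patterns of the other two; it
absorbs the choice of `√-27`. -/
theorem cubicEigenvalues_div {q : ℕ} (hq : q ≠ 0) (n : ℕ) {z : ℂ} (hz : z ≠ 0) :
    cubicEigenvalues q n (q / z) = cubicEigenvalues q n z := by
  have h0 := zeta3_ne_zero
  have h1 : zeta3 * (q / z) = q / (zeta3 ^ 2 * z) := by
    field_simp; linear_combination zeta3_cube
  have h2 : zeta3 ^ 2 * (q / z) = q / (zeta3 * z) := by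
    field_simp; linear_combination zeta3_cube
  rw [cubicEigenvalues, cubicEigenvalues, h1, h2, cubicEigenvalue_div hq, cubicEigenvalue_div hq, cubicEigenvalue_div hq]
  abel

/-! ### The spectrum through Gauss sums -/

open Classical in
/-- The sum of `ψ` over the dilated set of cubes, in terms of Gauss sums. -/
theorem sum_cubes_eq_gaussSum {F : Type*} [Field F] [Fintype F] {χ : MulChar F ℂ}
    (h3 : χ ^ 3 = 1) (h1 : χ ≠ 1) (ψ : AddChar F ℂ) :
    3 * ∑ s : F, (if ∃ x : F, x ≠ 0 ∧ s = x ^ 3 then (1 : ℂ) else 0) * ψ s =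
      gaussSum 1 ψ + gaussSum χ ψ + gaussSum χ⁻¹ ψ := by
  rw [gaussSum, gaussSum, gaussSum, ← Finset.sum_add_distrib, ← Finset.sum_add_distrib,
    Finset.mul_sum]
  refine Finset.sum_congr rfl fun s _ => ?_
  have h : (∃ x : F, x ≠ 0 ∧ s = x ^ 3) ↔ s ≠ 0 ∧ χ s = 1 := by
    constructor
    · rintro ⟨x, hx, rfl⟩
      exact ⟨pow_ne_zero _ hx, (MulChar.cubic_apply_eq_one_iff h3 h1 (pow_ne_zero _ hx)).mpr
        ⟨x, hx, rfl⟩⟩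
    · rintro ⟨hs, h⟩
      exact (MulChar.cubic_apply_eq_one_iff h3 h1 hs).mp h
  have := MulChar.cubic_indicator h3 (one_pow 3) s
  simp only [h]
  linear_combination -(ψ s) * this

theorem MulChar.cubic_apply_neg_one {F : Type*} [Field F] {R : Type*} [CommRing R]
    {χ : MulChar F R} (h3 : χ ^ 3 = 1) : χ (-1) = 1 := by
  have := MulChar.cubic_apply_pow h3 (neg_ne_zero.mpr (one_ne_zero (α := F)))
  rwa [← map_pow, show (-1 : F) ^ 3 = -1 by ring] at this

theorem gaussSum_cubic_mul_inv {F : Type*} [Field F] [Fintype F] {χ : MulChar F ℂ}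
    (h3 : χ ^ 3 = 1) (h1 : χ ≠ 1) {ψ : AddChar F ℂ} (hψ : ψ.IsPrimitive) :
    gaussSum χ ψ * gaussSum χ⁻¹ ψ = Fintype.card F := by
  have h3' : χ⁻¹ ^ 3 = 1 := by rw [inv_pow, h3, inv_one]
  rw [← mul_gaussSum_inv_eq_gaussSum χ⁻¹ ψ, MulChar.cubic_apply_neg_one h3', one_mul,
    gaussSum_mul_gaussSum_eq_card h1 hψ]

/-- The spectrum of `Γ(3, q)` in terms of a cubic Gauss sum. -/
theorem gpGraph_three_spec {F : Type*} [Field F] [Fintype F] (h3q : 3 ∣ Fintype.card F - 1)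
    {χ : MulChar F ℂ} (h3 : χ ^ 3 = 1)
    (h1 : χ ≠ 1) {ψ : AddChar F ℂ} (hψ : ψ.IsPrimitive) :
    (gpGraph 3 F).spec = (((Fintype.card F - 1) / 3 : ℕ) : ℂ) ::ₘ
      cubicEigenvalues (Fintype.card F) ((Fintype.card F - 1) / 3) (gaussSum χ ψ) := by
  classical
  set q := Fintype.card F with hq
  set n := (q - 1) / 3 with hn
  set f : F → ℂ := fun s => if ∃ x : F, x ≠ 0 ∧ s = x ^ 3 then (1 : ℂ) else 0 with hf
  have hadj : (gpGraph 3 F).adjMatrix = Matrix.of fun u v => f (v - u) := by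
    ext u v
    simp only [Digraph.adjMatrix, gpGraph, Matrix.of_apply, hf]
    congr
  have hg0 : gaussSum χ ψ ≠ 0 := gaussSum_ne_zero_of_nontrivial (by simp) h1 hψ
  have hzero : ∑ s, f s * ψ (0 * s) = n := by
    -- For the trivial additive character the two cubic Gauss sums vanish and the remaining one is
    -- `q - 1`.
    have := sum_cubes_eq_gaussSum h3 h1 (1 : AddChar F ℂ)
    rw [gaussSum_one_right h1, gaussSum_one_right (inv_ne_one.mpr h1), gaussSum_one_one,
      Nat.card_eq_fintype_card, Fintype.card_units, ← hq, ← Nat.div_mul_cancel h3q,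
      ← hn] at this
    push_cast at this
    simp only [zero_mul, AddChar.map_zero_eq_one]
    linear_combination this / 3
  have hne : ∀ a ∈ Finset.univ.erase (0 : F), ∑ s, f s * ψ (a * s) =
      cubicEigenvalue q (χ⁻¹ a * gaussSum χ ψ) := by
    intro a ha
    have ha := Finset.ne_of_mem_erase ha
    have h : 3 * ∑ s, f s * ψ (a * s) = gaussSum 1 (ψ.mulShift a) + gaussSum χ (ψ.mulShift a) +
        gaussSum χ⁻¹ (ψ.mulShift a) := sum_cubes_eq_gaussSum h3 h1 (ψ.mulShift a)
    have e1 := gaussSum_mulShift_eq χ ψ (Units.mk0 a ha)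
    have e2 := gaussSum_mulShift_eq χ⁻¹ ψ (Units.mk0 a ha)
    rw [Units.val_mk0] at e1 e2
    rw [gaussSum_one_left (hψ ha), e1, e2, inv_inv] at h
    have hχ : χ a ≠ 0 := (ha.isUnit.map χ).ne_zero
    have hg := gaussSum_cubic_mul_inv h3 h1 hψ
    rw [cubicEigenvalue, MulChar.inv_apply_eq_inv', ← hg]
    rw [MulChar.inv_apply_eq_inv'] at h
    field_simp at h ⊢
    linear_combination h
  have h3' : χ⁻¹ ^ 3 = 1 := by rw [inv_pow, h3, inv_one]
  rw [Digraph.spec, hadj]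
  rw [charpoly_of_sub_eq_prod hψ f,
    ← Finset.mul_prod_erase _ _ (Finset.mem_univ (0 : F)), hzero,
    Finset.prod_congr rfl fun a ha => by rw [hne a ha],
    MulChar.prod_cubic h3' (inv_ne_one.mpr h1)
      (fun t => Polynomial.X - Polynomial.C (cubicEigenvalue q (t * gaussSum χ ψ))),
    ← hq, ← hn, one_mul]
  have hmon : ∀ z : ℂ, (Polynomial.X - Polynomial.C z : Polynomial ℂ) ≠ 0 :=
    fun z => Polynomial.X_sub_C_ne_zero z
  have hpow : ∀ z : ℂ, ((Polynomial.X - Polynomial.C z : Polynomial ℂ)) ^ n ≠ 0 :=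
    fun z => pow_ne_zero _ (hmon z)
  rw [Polynomial.roots_mul (mul_ne_zero (hmon _)
      (mul_ne_zero (mul_ne_zero (hpow _) (hpow _)) (hpow _))),
    Polynomial.roots_mul (mul_ne_zero (mul_ne_zero (hpow _) (hpow _)) (hpow _)),
    Polynomial.roots_mul (mul_ne_zero (hpow _) (hpow _))]
  simp only [Polynomial.roots_pow, Polynomial.roots_X_sub_C, Multiset.nsmul_singleton]
  rw [cubicEigenvalues, Multiset.singleton_add]

/-! ### Jacobi sums modulo `p` and binomial coefficients -/

/-- All base-`p` digits of `(p ^ m - 1) / 3` equal `e = (p - 1) / 3`, and `2 e < p`, so doubling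
produces no carry. By Lucas the coefficient is a product of factors `(2 e).choose e` modulo `p`,
each prime to `p`. -/
theorem Nat.Prime.not_dvd_choose_two_mul_third {p : ℕ} (hp : p.Prime) (h1 : p % 3 = 1) (m : ℕ) :
    ¬ p ∣ (2 * ((p ^ m - 1) / 3)).choose ((p ^ m - 1) / 3) := by
  have := Fact.mk hp
  induction m with
  | zero => simpa using hp.ne_one
  | succ m ih =>
    have hm : p ^ m % 3 = 1 := by simp [Nat.pow_mod, h1]
    obtain ⟨e, he⟩ : ∃ e, p = 3 * e + 1 := ⟨p / 3, by omega⟩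
    obtain ⟨K, hK⟩ : ∃ K, p ^ m = 3 * K + 1 := ⟨p ^ m / 3, by omega⟩
    have hm' : (p ^ m - 1) / 3 = K := by omega
    have hs : (p ^ (m + 1) - 1) / 3 = e + p * K := by
      have : p ^ (m + 1) = 3 * (e + p * K) + 1 := by
        rw [pow_succ, hK]
        nlinarith
      omega
    have hp0 : 0 < p := hp.pos
    have h2 : 2 * (e + p * K) = 2 * e + p * (2 * K) := by ring
    rw [hm'] at ih
    rw [hs, h2, (Choose.choose_modEq_choose_mod_mul_choose_div_nat (p := p)).dvd_iff dvd_rfl,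
      Nat.add_mul_mod_self_left, Nat.add_mul_mod_self_left, Nat.add_mul_div_left _ _ hp0,
      Nat.add_mul_div_left _ _ hp0, Nat.mod_eq_of_lt (by omega), Nat.mod_eq_of_lt (by omega),
      Nat.div_eq_of_lt (by omega), Nat.div_eq_of_lt (by omega), zero_add, zero_add, hp.dvd_mul]
    rintro (h | h)
    · have hd : (2 * e).choose e ∣ (2 * e).factorial := by
        rw [← Nat.choose_mul_factorial_mul_factorial (show e ≤ 2 * e by omega), mul_assoc]
        exact dvd_mul_right _ _
      have := hp.dvd_factorial.mp (h.trans hd)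
      omega
    · exact ih h

theorem FiniteField.sum_pow_of_pos {F : Type*} [Field F] [Fintype F] {i : ℕ} (hi : 0 < i) :
    ∑ x : F, x ^ i = if Fintype.card F - 1 ∣ i then -1 else 0 := by
  classical
  rw [← FiniteField.sum_pow_units F i, ← Finset.add_sum_erase _ _ (Finset.mem_univ (0 : F)),
    zero_pow hi.ne', zero_add]
  refine (Finset.sum_bij (fun (u : Fˣ) _ => (u : F)) (by simp) (by simp [Units.ext_iff]) ?_
    (by simp)).symm
  intro b hb
  exact ⟨Units.mk0 b (Finset.ne_of_mem_erase hb), Finset.mem_univ _, rfl⟩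

/-- The Jacobi sum of the character `x ↦ x ^ (2 k)`, where `#F - 1 = 3 k`. -/
theorem FiniteField.sum_pow_mul_one_sub_pow {F : Type*} [Field F] [Fintype F] {k : ℕ} (hk : 0 < k)
    (hF : Fintype.card F - 1 = 3 * k) :
    ∑ x : F, x ^ (2 * k) * (1 - x) ^ (2 * k) = -((-1) ^ k * ((2 * k).choose k : F)) := by
  have hterm : ∀ x : F, x ^ (2 * k) * (1 - x) ^ (2 * k) = ∑ j ∈ Finset.range (2 * k + 1),
      (-1) ^ j * ((2 * k).choose j : F) * x ^ (2 * k + j) := by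
    intro x
    rw [show 1 - x = -x + 1 by ring, add_pow, Finset.mul_sum]
    refine Finset.sum_congr rfl fun j _ => ?_
    rw [neg_pow x j, one_pow, pow_add]
    ring
  rw [Finset.sum_congr rfl fun x _ => hterm x, Finset.sum_comm]
  simp_rw [← Finset.mul_sum]
  -- A power sum over `F` vanishes unless `3 k` divides the exponent. The exponents `2 k + j` lie
  -- between `2 k` and `4 k`, so only `j = k` contributes.
  rw [Finset.sum_eq_single_of_mem k (by simp; omega)]
  · rw [FiniteField.sum_pow_of_pos (by omega), if_pos (by rw [hF]; exact ⟨1, by ring⟩)]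
    ring
  · intro j hj hjk
    rw [FiniteField.sum_pow_of_pos (by omega), if_neg, mul_zero]
    rw [hF]
    rintro ⟨c, hc⟩
    rw [Finset.mem_range] at hj
    have : c = 1 := by
      rcases Nat.lt_or_ge c 2 with h | h
      · interval_cases c <;> omega
      · nlinarith
    subst this
    omega

/-! ### Eisenstein integers -/

/-- The ring of Eisenstein integers. -/
abbrev Eisenstein := QuadraticAlgebra ℤ (-1) (-1)

namespace Eisenstein

/-- The homomorphism sending the generator to a root of `X ^ 2 + X + 1`. -/
def evalHom {A : Type*} [CommRing A] (u : A) (hu : u ^ 2 + u + 1 = 0) : Eisenstein →+* A :=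
  (QuadraticAlgebra.lift (R := ℤ) (a := -1) (b := -1)
    ⟨u, by simp only [neg_smul, one_smul]; linear_combination hu⟩).toRingHom

theorem evalHom_apply {A : Type*} [CommRing A] (u : A) (hu : u ^ 2 + u + 1 = 0) (z : Eisenstein) :
    evalHom u hu z = z.re + z.im * u := by
  simp [evalHom, QuadraticAlgebra.lift]

theorem evalHom_omega {A : Type*} [CommRing A] (u : A) (hu : u ^ 2 + u + 1 = 0) :
    evalHom u hu QuadraticAlgebra.omega = u := by
  simp [evalHom_apply]

theorem omega_sq : (QuadraticAlgebra.omega : Eisenstein) ^ 2 + QuadraticAlgebra.omega + 1 = 0 := by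
  ext <;> simp [pow_two, QuadraticAlgebra.re_one, QuadraticAlgebra.im_one]

/-- The embedding in the complex numbers. -/
noncomputable def toComplex : Eisenstein →+* ℂ := evalHom zeta3 zeta3_sq

theorem toComplex_apply (z : Eisenstein) : toComplex z = z.re + z.im * zeta3 :=
  evalHom_apply _ _ z

end Eisenstein

theorem zeta3_eq : zeta3 = -1 / 2 + (Real.sqrt 3 / 2 : ℝ) * Complex.I := by
  have h : (2 * Real.pi * Complex.I / 3 : ℂ) = ((2 * Real.pi / 3 : ℝ) : ℂ) * Complex.I := by
    push_cast; ring
  rw [zeta3, h, Complex.exp_mul_I, ← Complex.ofReal_cos, ← Complex.ofReal_sin,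
    show 2 * Real.pi / 3 = Real.pi - Real.pi / 3 by ring, Real.cos_pi_sub, Real.sin_pi_sub,
    Real.cos_pi_div_three, Real.sin_pi_div_three]
  push_cast; ring

theorem zeta3_im_ne_zero : zeta3.im ≠ 0 := by
  rw [zeta3_eq]; simp

namespace Eisenstein

theorem toComplex_injective : Function.Injective toComplex := by
  rw [injective_iff_map_eq_zero]
  intro z hz
  rw [toComplex_apply] at hz
  have him := congrArg Complex.im hz
  have hre := congrArg Complex.re hz
  simp only [Complex.add_im, Complex.add_re, Complex.intCast_im, Complex.mul_im, Complex.mul_re,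
    Complex.intCast_re, zero_mul, add_zero, zero_add, Complex.zero_im, Complex.zero_re,
    sub_zero] at him hre
  have h0 : z.im = 0 := by
    rcases mul_eq_zero.mp him with h | h
    · exact_mod_cast h
    · exact absurd h zeta3_im_ne_zero
  rw [h0] at hre
  have h1 : z.re = 0 := by
    simpa using hre
  ext <;> simp [h0, h1]

instance : IsDomain Eisenstein := toComplex_injective.isDomain toComplex

theorem omega_isPrimitiveRoot : IsPrimitiveRoot (QuadraticAlgebra.omega : Eisenstein) 3 := by
  refine IsPrimitiveRoot.of_map_of_injective (f := toComplex) ?_ toComplex_injective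
  rw [toComplex, evalHom_omega]
  exact zeta3_isPrimitiveRoot

end Eisenstein

/-! ### Cubic Jacobi sums and the form `A² + 27 B²` -/

open QuadraticAlgebra in
/-- A cubic character with values in the Eisenstein integers, adapted to a generator. -/
theorem exists_cubic_mulChar_generator (F : Type*) [Field F] [Fintype F]
    (h3 : 3 ∣ Fintype.card F - 1) :
    ∃ (χ : MulChar F Eisenstein) (g : Fˣ), (∀ x : Fˣ, x ∈ Submonoid.powers g) ∧ χ g = omega ∧
      χ ^ 3 = 1 ∧ χ ≠ 1 := by
  classical
  obtain ⟨g, hg⟩ := IsCyclic.exists_monoid_generator (α := Fˣ)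
  have hz : ∀ x, x ∈ Subgroup.zpowers g := fun x => by
    obtain ⟨k, hk⟩ := hg x
    exact ⟨k, by simpa using hk⟩
  have hω := Eisenstein.omega_isPrimitiveRoot
  let w : Eisensteinˣ := (hω.isUnit three_ne_zero).unit
  have hw : w ∈ rootsOfUnity (Fintype.card Fˣ) Eisenstein := by
    rw [mem_rootsOfUnity, Units.ext_iff]
    rw [← Fintype.card_units] at h3
    obtain ⟨c, hc⟩ := h3
    rw [hc, pow_mul]
    simp [w, hω.pow_eq_one]
  have hχ : MulChar.ofRootOfUnity hw hz g = omega := MulChar.ofRootOfUnity_spec hw hz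
  refine ⟨MulChar.ofRootOfUnity hw hz, g, hg, hχ, ?_, ?_⟩
  · rw [MulChar.eq_iff hz, MulChar.pow_apply_coe, hχ, MulChar.one_apply_coe, hω.pow_eq_one]
  · intro h
    rw [h, MulChar.one_apply_coe] at hχ
    exact hω.ne_one (by norm_num) hχ.symm

open QuadraticAlgebra in
/-- A cubic Jacobi sum is congruent to `-1` modulo `3`. -/
theorem cubic_jacobiSum_congr {F : Type*} [Field F] [Fintype F] {χ : MulChar F Eisenstein}
    (h3q : 3 ∣ Fintype.card F - 1) (h3 : χ ^ 3 = 1) :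
    (3 : ℤ) ∣ (jacobiSum χ χ).re + 1 ∧ (3 : ℤ) ∣ (jacobiSum χ χ).im := by
  obtain ⟨z, -, hz⟩ := exists_jacobiSum_eq_neg_one_add (by norm_num) h3 h3 h3q
    Eisenstein.omega_isPrimitiveRoot
  -- The Jacobi sum is `-1` plus a multiple of `(ω - 1)²`, and this square is `3` times a unit.
  have hω : (omega - 1 : Eisenstein) ^ 2 = -3 * omega := by
    linear_combination Eisenstein.omega_sq
  rw [hz, hω]
  constructor
  · refine ⟨z.im, ?_⟩
    simp [QuadraticAlgebra.re_one]
    ring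
  · refine ⟨z.im - z.re, ?_⟩
    simp [QuadraticAlgebra.im_one]
    ring

open QuadraticAlgebra in
/-- A cubic Jacobi sum is prime to the characteristic `p ≡ 1 (mod 3)`. -/
theorem cubic_jacobiSum_not_dvd {F : Type*} [Field F] [Fintype F] {p m : ℕ} (hp : p.Prime)
    (h1 : p % 3 = 1) (hF : Fintype.card F = p ^ m) {χ : MulChar F Eisenstein} {g : Fˣ}
    (hg : ∀ x : Fˣ, x ∈ Submonoid.powers g) (hχ : χ g = omega) :
    ¬ (p : Eisenstein) ∣ jacobiSum χ χ := by
  classical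
  have := Fact.mk hp
  have hm0 : m ≠ 0 := by
    rintro rfl
    exact Fintype.one_lt_card.ne' (hF.trans (pow_zero p))
  have hchar : CharP F p := charP_of_card_eq_prime_pow hF
  have hpm : p ^ m % 3 = 1 := by simp [Nat.pow_mod, h1]
  obtain ⟨k, hk⟩ : ∃ k, p ^ m = 3 * k + 1 := ⟨p ^ m / 3, by omega⟩
  have hk' : (p ^ m - 1) / 3 = k := by omega
  have hk0 : 0 < k := by
    have : 1 < p ^ m := hF ▸ Fintype.one_lt_card
    omega
  have hcard : Fintype.card F - 1 = 3 * k := by omega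
  have hord : orderOf g = 3 * k := by
    rw [orderOf_eq_card_of_forall_mem_zpowers fun x => ?_, Nat.card_eq_fintype_card,
      Fintype.card_units, hcard]
    obtain ⟨k, hk⟩ := hg x
    exact ⟨k, by simpa using hk⟩
  -- Sending `ω` to `u` reduces modulo a prime above `p` and turns `χ` into `x ↦ x ^ (2 k)`. The
  -- exponent matters: with `g ^ k` instead, the reduced sum has degree `2 k < 3 k` and vanishes.
  set u : F := (g : F) ^ (2 * k) with hu
  have hu3 : u ^ 3 = 1 := by
    rw [hu, ← pow_mul, ← Units.val_pow_eq_pow_val,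
      show 2 * k * 3 = orderOf g * 2 by rw [hord]; ring, pow_mul, pow_orderOf_eq_one]
    simp
  have hu1 : u - 1 ≠ 0 := by
    intro h
    have h : g ^ (2 * k) = 1 := by
      rw [Units.ext_iff, Units.val_pow_eq_pow_val, Units.val_one]
      exact sub_eq_zero.mp h
    have := Nat.le_of_dvd (by omega) (orderOf_dvd_of_pow_eq_one h)
    omega
  have hu2 : u ^ 2 + u + 1 = 0 := by
    have : (u - 1) * (u ^ 2 + u + 1) = 0 := by linear_combination hu3
    exact (mul_eq_zero.mp this).resolve_left hu1
  let φ := Eisenstein.evalHom u hu2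
  have hφ : ∀ x : F, φ (χ x) = x ^ (2 * k) := by
    intro x
    rcases eq_or_ne x 0 with rfl | hx
    · rw [MulChar.map_zero, map_zero, zero_pow (by omega)]
    · obtain ⟨i, hi⟩ := hg (Units.mk0 x hx)
      have hx' : x = (g : F) ^ i := by
        have := congrArg Units.val hi
        simpa using this.symm
      rw [hx', map_pow, hχ, map_pow, Eisenstein.evalHom_omega, hu, ← pow_mul, ← pow_mul, mul_comm]
  have hJ : φ (jacobiSum χ χ) = -((-1) ^ k * ((2 * k).choose k : F)) := by
    rw [← FiniteField.sum_pow_mul_one_sub_pow hk0 hcard, jacobiSum, map_sum]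
    refine Finset.sum_congr rfl fun x _ => ?_
    rw [map_mul, hφ, hφ]
  rintro ⟨c, hc⟩
  rw [hc, map_mul, map_natCast, CharP.cast_eq_zero, zero_mul] at hJ
  have h0 : ((2 * k).choose k : F) = 0 := by
    have := neg_eq_zero.mp hJ.symm
    exact (mul_eq_zero.mp this).resolve_left (pow_ne_zero _ (neg_ne_zero.mpr one_ne_zero))
  rw [CharP.cast_eq_zero_iff F p] at h0
  exact hk' ▸ hp.not_dvd_choose_two_mul_third h1 m <| hk'.symm ▸ h0

/-- The quadratic form attached to a cubic Jacobi sum over a field with `p ^ m` elements. -/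
theorem exists_cubic_jacobiSum (F : Type*) [Field F] [Fintype F] {p m : ℕ} (hp : p.Prime)
    (hF : Fintype.card F = p ^ m) (h3q : 3 ∣ Fintype.card F - 1) :
    ∃ (χ : MulChar F ℂ) (A B : ℤ), χ ^ 3 = 1 ∧ χ ≠ 1 ∧
      2 * jacobiSum χ χ = A + 3 * (2 * zeta3 + 1) * B ∧
      4 * (p : ℤ) ^ m = A ^ 2 + 27 * B ^ 2 ∧ A ≡ 1 [ZMOD 3] ∧
      (p % 3 = 1 → ¬ (p : ℤ) ∣ A) ∧ (p % 3 = 2 → B = 0) := by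
  obtain ⟨χ, g, hg, hχg, h3, h1⟩ := exists_cubic_mulChar_generator F h3q
  set J := jacobiSum χ χ with hJ
  obtain ⟨hre, b, hb⟩ := cubic_jacobiSum_congr h3q h3
  rw [← hJ] at hre hb
  let χ' := χ.ringHomComp Eisenstein.toComplex
  have h3' : χ' ^ 3 = 1 := by
    rw [MulChar.ringHomComp_pow, h3, MulChar.ringHomComp_one]
  have h1' : χ' ≠ 1 := (MulChar.ringHomComp_ne_one_iff Eisenstein.toComplex_injective).mpr h1
  have hJ' : jacobiSum χ' χ' = J.re + J.im * zeta3 := by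
    rw [jacobiSum_ringHomComp, Eisenstein.toComplex_apply]
  have hinv : χ'⁻¹ = χ' ^ 2 := by
    rw [inv_eq_iff_mul_eq_one, ← pow_succ', h3']
  have hstar : jacobiSum χ'⁻¹ χ'⁻¹ = star (jacobiSum χ' χ') := by
    simp only [jacobiSum, star_sum, star_mul', MulChar.star_apply']
  have hzstar : star zeta3 = -1 - zeta3 := by
    rw [zeta3_eq]
    simp
    ring
  have hstarJ : star (jacobiSum χ' χ') = J.re + J.im * (-1 - zeta3) := by
    rw [hJ', star_add, star_mul', hzstar]
    simp
  have hnorm : (J.re : ℂ) ^ 2 - J.re * J.im + J.im ^ 2 = (p : ℂ) ^ m := by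
    have hχχ : χ' * χ' ≠ 1 := by
      rw [← pow_two, ← hinv]
      exact inv_ne_one.mpr h1'
    have h := jacobiSum_mul_jacobiSum_inv (F' := ℂ) (F := F) ?_ h1' h1' hχχ
    · rw [hstar, hstarJ, hJ', hF] at h
      push_cast at h
      linear_combination h + (J.im : ℂ) ^ 2 * zeta3_sq
    · rw [ringChar.eq_zero]
      exact (CharP.char_ne_zero_of_finite F (ringChar F)).symm
  have hnorm' : J.re ^ 2 - J.re * J.im + J.im ^ 2 = (p : ℤ) ^ m := by exact_mod_cast hnorm
  -- From `J = re + im ω` one gets `2 J = (2 re - im) + im (2 ω + 1)`, with `im = 3 b`; here `3 (2 ω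
  -- + 1)` is a square root of `-27`.
  refine ⟨χ', 2 * J.re - J.im, b, h3', h1', ?_, ?_, ?_, ?_, ?_⟩
  · rw [hJ', hb]
    push_cast
    ring
  · rw [← hnorm', hb]
    ring
  · rw [Int.modEq_iff_dvd]
    omega
  · intro hp1 hdvd
    refine cubic_jacobiSum_not_dvd hp hp1 hF hg hχg ?_
    have hp' : Prime (p : ℤ) := Nat.prime_iff_prime_int.mp hp
    have hp7 : 5 < p := by
      have := hp.two_le
      by_contra! h
      interval_cases p <;> first | omega | norm_num at hp
    have hm0 : m ≠ 0 := by
      rintro rfl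
      exact Fintype.one_lt_card.ne' (hF.trans (pow_zero p))
    have hndvd : ∀ c : ℕ, 0 < c → c ≤ 3 → ¬ (p : ℤ) ∣ c := by
      intro c hc hc' h
      have := Nat.le_of_dvd hc (Int.natCast_dvd_natCast.mp h)
      omega
    -- If `p ∣ A`, the norm equation forces `p` to divide both coordinates of `J`, hence `J` itself.
    have hb27 : (p : ℤ) ∣ 3 * (J.im * J.im) := by
      have h1 : (p : ℤ) ∣ 4 * (p : ℤ) ^ m := (dvd_pow_self _ hm0).mul_left _
      have : 3 * (J.im * J.im) = 4 * (p : ℤ) ^ m - (2 * J.re - J.im) * (2 * J.re - J.im) := by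
        rw [← hnorm']; ring
      rw [this]
      exact dvd_sub h1 (hdvd.mul_left _)
    have him : (p : ℤ) ∣ J.im := by
      have h := (hp'.dvd_or_dvd hb27).resolve_left (hndvd 3 (by norm_num) le_rfl)
      exact (hp'.dvd_or_dvd h).elim id id
    have hre2 : (p : ℤ) ∣ J.re := by
      have : (p : ℤ) ∣ 2 * J.re := by
        have := dvd_add hdvd him
        rwa [sub_add_cancel] at this
      exact (hp'.dvd_or_dvd this).resolve_left (hndvd 2 (by norm_num) (by norm_num))
    obtain ⟨x, hx⟩ := hre2
    obtain ⟨y, hy⟩ := him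
    refine ⟨⟨x, y⟩, ?_⟩
    ext
    · simpa using hx
    · simpa using hy
  · intro hp2
    have := Fact.mk hp
    have hchar : CharP F p := charP_of_card_eq_prime_pow hF
    -- Frobenius permutes `F` and commutes with `x ↦ 1 - x`. As `χ ^ p = χ⁻¹` when `p ≡ 2 (mod 3)`,
    -- the Jacobi sum equals its conjugate.
    have hfrob : jacobiSum (χ' ^ p) (χ' ^ p) = jacobiSum χ' χ' := by
      have hbij : Function.Bijective (fun x : F => x ^ p) :=
        Finite.injective_iff_bijective.mp (frobenius_inj F p)
      conv_rhs => rw [jacobiSum, ← hbij.sum_comp]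
      refine Finset.sum_congr rfl fun x _ => ?_
      rw [MulChar.pow_apply' _ hp.ne_zero, MulChar.pow_apply' _ hp.ne_zero, ← map_pow, ← map_pow,
        sub_pow_char, one_pow]
    have hpow : χ' ^ p = χ'⁻¹ := by
      rw [hinv, ← Nat.div_add_mod p 3, hp2, pow_add, pow_mul, h3', one_pow, one_mul]
    rw [hpow, hstar, hstarJ, hJ'] at hfrob
    have h0 : (J.im : ℂ) * (2 * zeta3 + 1) = 0 := by linear_combination -hfrob
    have hz : 2 * zeta3 + 1 ≠ 0 := by
      intro h
      have := congrArg Complex.im h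
      simp [zeta3_im_ne_zero] at this
    have : J.im = 0 := by exact_mod_cast (mul_eq_zero.mp h0).resolve_right hz
    omega

/-- The spectrum of `Γ(3, q)` in terms of a representation of `4 q` by `A² + 27 B²`. -/
theorem exists_rep_gpGraph_three_spec (F : Type*) [Field F] [Fintype F] {p m : ℕ} (hp : p.Prime)
    (hF : Fintype.card F = p ^ m) (h3q : 3 ∣ Fintype.card F - 1) :
    ∃ A B : ℤ, 4 * (p : ℤ) ^ m = A ^ 2 + 27 * B ^ 2 ∧ A ≡ 1 [ZMOD 3] ∧
      (p % 3 = 1 → ¬ (p : ℤ) ∣ A) ∧ (p % 3 = 2 → B = 0) ∧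
      ∀ s z : ℂ, s ^ 2 = -27 → 2 * z ^ 3 = (p : ℂ) ^ m * (A + s * B) →
        (gpGraph 3 F).spec = (((p ^ m - 1) / 3 : ℕ) : ℂ) ::ₘ
          cubicEigenvalues (p ^ m) ((p ^ m - 1) / 3) z := by
  obtain ⟨χ, A, B, h3, h1, hJ, hAB, hA, hp1, hp2⟩ := exists_cubic_jacobiSum F hp hF h3q
  refine ⟨A, B, hAB, hA, hp1, hp2, fun s z hs hz => ?_⟩
  obtain ⟨ψ, hψ⟩ : ∃ ψ : AddChar F ℂ, ψ.IsPrimitive :=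
    ⟨_, AddChar.FiniteField.primitiveChar_to_Complex_isPrimitive F⟩
  have hord : orderOf χ = 3 := by
    have := Fact.mk Nat.prime_three
    exact orderOf_eq_prime h3 h1
  have hg := gaussSum_pow_eq_prod_jacobiSum (χ := χ) (by omega) hψ
  rw [hord, MulChar.cubic_apply_neg_one h3, hF] at hg
  have hg3 : gaussSum χ ψ ^ 3 = (p : ℂ) ^ m * jacobiSum χ χ := by
    simpa using hg
  rw [gpGraph_three_spec h3q h3 h1 hψ, hF]
  congr 1
  have hq0 : (p : ℂ) ^ m ≠ 0 := pow_ne_zero _ (Nat.cast_ne_zero.mpr hp.ne_zero)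
  have hAB' : 4 * (p : ℂ) ^ m = A ^ 2 + 27 * B ^ 2 := by exact_mod_cast hAB
  have hw : (3 * (2 * zeta3 + 1)) ^ 2 = -27 := by linear_combination 36 * zeta3_sq
  have hss : (s - 3 * (2 * zeta3 + 1)) * (s + 3 * (2 * zeta3 + 1)) = 0 := by
    linear_combination hs - hw
  -- Either `s` is the root `3 (2 ω + 1)` and `z³ = G³`, or it is the opposite root and `(q / z)³ =
  -- G³`.
  rcases mul_eq_zero.mp hss with h | h
  · refine cubicEigenvalues_congr _ _ ?_
    rw [hg3]
    linear_combination (p : ℂ) ^ m * hJ / 2 - hz / 2 - (p : ℂ) ^ m * B * h / 2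
  · have hz0 : z ≠ 0 := by
      rintro rfl
      have h0 : (A + s * B : ℂ) = 0 := by simpa [hq0] using hz
      apply mul_ne_zero (by norm_num : (4 : ℂ) ≠ 0) hq0
      linear_combination hAB' + (A - s * B) * h0 + B ^ 2 * hs
    rw [← cubicEigenvalues_div (pow_ne_zero m hp.ne_zero) _ hz0]
    refine cubicEigenvalues_congr _ _ ?_
    rw [hg3, div_pow, eq_div_iff (pow_ne_zero 3 hz0)]
    push_cast
    linear_combination (p : ℂ) ^ m * jacobiSum χ χ * hz / 2 +
      (p : ℂ) ^ m * (p : ℂ) ^ m * (A + s * B) * hJ / 4 +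
      ((p : ℂ) ^ m) ^ 2 * (A + s * B) * B * h / 4 - ((p : ℂ) ^ m) ^ 2 * hAB' / 4
      - ((p : ℂ) ^ m) ^ 2 * B ^ 2 * hs / 4

/-! ### Uniqueness of the representation by `a² + 27 b²` -/

/-- Brahmagupta's identity gives `(a c + 27 b d)² + 27 (a d - b c)² = 16 N²`. A nonzero multiple `a
d - b c` of `N` would contribute at least `27 N²`, so `a d = b c`. The two pairs are then
proportional with equal norms, and the congruence modulo `3` fixes the sign. -/
theorem Int.eq_of_sq_add_twentySeven_mul_sq_of_dvd {N a b c d : ℤ} (hN : 0 < N)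
    (hab : 4 * N = a ^ 2 + 27 * b ^ 2) (hcd : 4 * N = c ^ 2 + 27 * d ^ 2)
    (ha : a ≡ 1 [ZMOD 3]) (hc : c ≡ 1 [ZMOD 3]) (h : N ∣ a * d - b * c) : c = a ∧ d = b := by
  obtain ⟨t, ht⟩ := h
  have hid : (a * c + 27 * b * d) ^ 2 + 27 * (a * d - b * c) ^ 2 = 16 * N ^ 2 := by
    have : (4 * N) * (4 * N) = (a ^ 2 + 27 * b ^ 2) * (c ^ 2 + 27 * d ^ 2) := by rw [← hab, ← hcd]
    linear_combination -this
  have ht0 : t = 0 := by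
    by_contra ht0
    have h1 : 1 ≤ t ^ 2 := by
      have : 0 < t ^ 2 := by positivity
      omega
    rw [ht] at hid
    nlinarith [sq_nonneg (a * c + 27 * b * d), sq_nonneg N, pow_pos hN 2]
  rw [ht0, mul_zero] at ht
  have hsq : 4 * N * a ^ 2 = 4 * N * c ^ 2 := by
    linear_combination a ^ 2 * hcd - c ^ 2 * hab + 27 * (a * d + b * c) * ht
  have hsq' := mul_left_cancel₀ (mul_pos four_pos hN).ne' hsq
  rw [Int.ModEq] at ha hc
  have hac : c = a := by
    rcases sq_eq_sq_iff_eq_or_eq_neg.mp hsq' with h | h <;> omega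
  refine ⟨hac, ?_⟩
  subst hac
  have hc0 : c ≠ 0 := by rintro rfl; norm_num at hc
  refine mul_left_cancel₀ hc0 ?_
  linear_combination ht

/-- Uniqueness of the representation `4 p ^ k = a² + 27 b²`. -/
theorem Int.sq_add_twentySeven_mul_sq_unique {p k : ℕ} (hp : p.Prime) (hp2 : p ≠ 2) {a b c d : ℤ}
    (hab : 4 * (p : ℤ) ^ k = a ^ 2 + 27 * b ^ 2) (hcd : 4 * (p : ℤ) ^ k = c ^ 2 + 27 * d ^ 2)
    (ha : a ≡ 1 [ZMOD 3]) (hc : c ≡ 1 [ZMOD 3]) (hpa : ¬ (p : ℤ) ∣ a) (hpc : ¬ (p : ℤ) ∣ c) :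
    c = a ∧ (d = b ∨ d = -b) := by
  have hp' : Prime (p : ℤ) := Nat.prime_iff_prime_int.mp hp
  have hN : 0 < (p : ℤ) ^ k := pow_pos (by exact_mod_cast hp.pos) k
  have hmul : (p : ℤ) ^ k ∣ (a * d - b * c) * (a * d + b * c) :=
    ⟨4 * (d ^ 2 - b ^ 2), by linear_combination b ^ 2 * hcd - d ^ 2 * hab⟩
  have hcop : ∀ x : ℤ, ¬ (p : ℤ) ∣ x → IsCoprime ((p : ℤ) ^ k) x :=
    fun x hx => ((hp'.coprime_iff_not_dvd).mpr hx).pow_left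
  have hp2' : ¬ (p : ℤ) ∣ 2 := by
    intro h
    exact hp2 ((Nat.prime_dvd_prime_iff_eq hp Nat.prime_two).mp (by exact_mod_cast h))
  -- If `p` misses one factor, all of `p ^ k` divides the other; the factor `a d + b c` is handled
  -- by changing the sign of `d`. If `p` divides both, then `p ∣ d`, which for `k > 0` contradicts
  -- `p ∤ c`.
  by_cases h1 : (p : ℤ) ∣ a * d - b * c
  · by_cases h2 : (p : ℤ) ∣ a * d + b * c
    · have hd : (p : ℤ) ∣ d := by
        have h : (p : ℤ) ∣ 2 * (a * d) := by
          have := dvd_add h1 h2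
          rwa [show a * d - b * c + (a * d + b * c) = 2 * (a * d) by ring] at this
        exact (hp'.dvd_or_dvd ((hp'.dvd_or_dvd h).resolve_left hp2')).resolve_left hpa
      rcases k.eq_zero_or_pos with rfl | hk
      · obtain ⟨h, h'⟩ := eq_of_sq_add_twentySeven_mul_sq_of_dvd hN hab hcd ha hc (by simp)
        exact ⟨h, Or.inl h'⟩
      · refine absurd (hp'.dvd_of_dvd_pow (n := 2) ?_) hpc
        have : c ^ 2 = 4 * (p : ℤ) ^ k - 27 * d ^ 2 := by linear_combination -hcd
        rw [this]
        exact dvd_sub ((dvd_pow_self _ hk.ne').mul_left _)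
          ((dvd_pow hd two_ne_zero).mul_left _)
    · obtain ⟨h, h'⟩ := eq_of_sq_add_twentySeven_mul_sq_of_dvd hN hab hcd ha hc
        ((hcop _ h2).dvd_of_dvd_mul_right hmul)
      exact ⟨h, Or.inl h'⟩
  · obtain ⟨h, h'⟩ := eq_of_sq_add_twentySeven_mul_sq_of_dvd (d := -d) hN hab
      (by rw [neg_sq]; exact hcd) ha hc (by
        rw [show a * -d - b * c = -(a * d + b * c) by ring, dvd_neg]
        exact (hcop _ h1).dvd_of_dvd_mul_left hmul)
    exact ⟨h, Or.inr (by rw [← h', neg_neg])⟩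

/-! ### The cubic equation: distinct and real roots -/

section Cardano

variable {q : ℕ} {A B : ℤ} {s z : ℂ}

theorem ne_zero_of_two_mul_cube_eq (hq : q ≠ 0) (hAB : 4 * (q : ℤ) = A ^ 2 + 27 * B ^ 2)
    (hs : s ^ 2 = -27) (hz : 2 * z ^ 3 = q * (A + s * B)) : z ≠ 0 := by
  rintro rfl
  have hq0 : (q : ℂ) ≠ 0 := Nat.cast_ne_zero.mpr hq
  have h0 : (A + s * B : ℂ) = 0 := by simpa [hq0] using hz
  have hAB' : 4 * (q : ℂ) = A ^ 2 + 27 * B ^ 2 := by exact_mod_cast hAB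
  apply mul_ne_zero (by norm_num : (4 : ℂ) ≠ 0) hq0
  linear_combination hAB' + (A - s * B) * h0 + B ^ 2 * hs

/-- The reduced eigenvalues are the roots of `X³ - 3 q X - q A`. -/
theorem add_div_cube_eq (hq : q ≠ 0) (hAB : 4 * (q : ℤ) = A ^ 2 + 27 * B ^ 2)
    (hs : s ^ 2 = -27) (hz : 2 * z ^ 3 = q * (A + s * B)) :
    (z + q / z) ^ 3 = q * (3 * (z + q / z) + A) := by
  have hz0 := ne_zero_of_two_mul_cube_eq hq hAB hs hz
  have hAB' : 4 * (q : ℂ) = A ^ 2 + 27 * B ^ 2 := by exact_mod_cast hAB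
  have h : (q / z) ^ 3 = q * (A - s * B) / 2 := by
    rw [div_pow, div_eq_iff (pow_ne_zero 3 hz0)]
    linear_combination (q : ℂ) ^ 2 * hAB' / 4 - q * (A - s * B) / 4 * hz
      + (q : ℂ) ^ 2 * B ^ 2 / 4 * hs
  have hzq : z * (q / z) = q := mul_div_cancel₀ _ hz0
  linear_combination hz / 2 + h + 3 * (z + q / z) * hzq

/-- Equality means `z + q / z = q`, and the cubic equation then gives `A = q (q - 3) ≥ 10`, which is
incompatible with `A² ≤ 4 q`. -/
theorem cubicEigenvalue_ne (hq : 5 ≤ q) (h3 : 3 ∣ q - 1)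
    (hAB : 4 * (q : ℤ) = A ^ 2 + 27 * B ^ 2)
    (hs : s ^ 2 = -27) (hz : 2 * z ^ 3 = q * (A + s * B)) :
    (((q - 1) / 3 : ℕ) : ℂ) ≠ cubicEigenvalue q z := by
  intro h
  have hx : z + q / z = q := by
    obtain ⟨n, hn⟩ := h3
    have hn' : q = 3 * n + 1 := by omega
    rw [cubicEigenvalue, hn, Nat.mul_div_cancel_left _ three_pos] at h
    have : (q : ℂ) = 3 * n + 1 := by exact_mod_cast hn'
    linear_combination -3 * h - this
  have hc := add_div_cube_eq (by omega) hAB hs hz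
  rw [hx] at hc
  have hc' : (q : ℤ) ^ 3 = q * (3 * q + A) := by exact_mod_cast hc
  have hq0 : (q : ℤ) ≠ 0 := by omega
  have hA : A = q * (q - 3) := by
    refine mul_left_cancel₀ hq0 ?_
    linear_combination -hc'
  have hq5 : (5 : ℤ) ≤ q := by exact_mod_cast hq
  have h10 : 10 ≤ A := by rw [hA]; nlinarith
  have : A * 10 ≤ A ^ 2 := by nlinarith
  nlinarith [sq_nonneg B]

/-- Otherwise `z w = q`, so `z⁶ = q³` and `(A + s B)² = 4 q = A² + 27 B²`. With `B ≠ 0` this yields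
`s A = 27 B`, and squaring gives `A² + 27 B² = 0`. -/
theorem eq_of_cubicEigenvalue_eq (hq : q ≠ 0) (hA : A ≠ 0) (hB : B ≠ 0)
    (hAB : 4 * (q : ℤ) = A ^ 2 + 27 * B ^ 2)
    (hs : s ^ 2 = -27) (hz : 2 * z ^ 3 = q * (A + s * B)) {w : ℂ} (hw : w ^ 3 = z ^ 3)
    (h : cubicEigenvalue q z = cubicEigenvalue q w) : z = w := by
  have hz0 := ne_zero_of_two_mul_cube_eq hq hAB hs hz
  have hw0 := ne_zero_of_two_mul_cube_eq hq hAB hs (z := w) (by rw [hw, hz])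
  have hq0 : (q : ℂ) ≠ 0 := Nat.cast_ne_zero.mpr hq
  have hAB' : 4 * (q : ℂ) = A ^ 2 + 27 * B ^ 2 := by exact_mod_cast hAB
  have h1 : (z - w) * (z * w - q) = 0 := by
    have h2 : z + q / z = w + q / w := by
      rw [cubicEigenvalue, cubicEigenvalue] at h
      linear_combination 3 * h
    field_simp at h2
    linear_combination h2
  rcases mul_eq_zero.mp h1 with h1 | h1
  · exact sub_eq_zero.mp h1
  · exfalso
    have h6 : (z ^ 3) ^ 2 = q ^ 3 := by
      have : (z * w) ^ 3 = q ^ 3 := by rw [sub_eq_zero.mp h1]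
      rw [mul_pow, hw] at this
      linear_combination this
    have h7 : (q : ℂ) ^ 2 * ((A + s * B) ^ 2 - 4 * q) = 0 := by
      linear_combination 4 * h6 - (2 * z ^ 3 + q * (A + s * B)) * hz
    have h8 : (2 * B : ℂ) * (s * A - 27 * B) = 0 := by
      have := (mul_eq_zero.mp h7).resolve_left (pow_ne_zero 2 hq0)
      linear_combination this + hAB' - B ^ 2 * hs
    have hB' : (2 * B : ℂ) ≠ 0 := mul_ne_zero two_ne_zero (Int.cast_ne_zero.mpr hB)
    have h9 := (mul_eq_zero.mp h8).resolve_left hB'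
    have h10 : (A : ℂ) ^ 2 + 27 * B ^ 2 = 0 := by
      linear_combination -(s * A + 27 * B) / 27 * h9 + (A : ℂ) ^ 2 / 27 * hs
    have h11 : A ^ 2 + 27 * B ^ 2 = 0 := by exact_mod_cast h10
    have : 0 < A ^ 2 := by positivity
    nlinarith [sq_nonneg B]

theorem Complex.re_eq_zero_of_sq_eq (hs : s ^ 2 = -27) : s.re = 0 ∧ s.im ^ 2 = 27 := by
  have h1 := congrArg Complex.re hs
  have h2 := congrArg Complex.im hs
  simp [pow_two] at h1 h2
  have him : s.im ≠ 0 := by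
    intro h
    rw [h] at h1
    nlinarith [mul_self_nonneg s.re]
  have hre : s.re = 0 := by
    have : s.re * s.im = 0 := by linarith
    exact (mul_eq_zero.mp this).resolve_right him
  rw [hre] at h1
  exact ⟨hre, by linarith⟩

/-- Since `s` is purely imaginary, `|A + s B|² = 4 q`. Hence `|z|² = q`, and `q / z` is the
conjugate of `z`. -/
theorem cubicEigenvalue_eq_ofReal (hq : q ≠ 0) (hAB : 4 * (q : ℤ) = A ^ 2 + 27 * B ^ 2)
    (hs : s ^ 2 = -27) (hz : 2 * z ^ 3 = q * (A + s * B)) :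
    cubicEigenvalue q z = (((2 * z.re - 1) / 3 : ℝ) : ℂ) := by
  have hz0 := ne_zero_of_two_mul_cube_eq hq hAB hs hz
  obtain ⟨hre, him⟩ := Complex.re_eq_zero_of_sq_eq hs
  have hAB' : 4 * (q : ℝ) = A ^ 2 + 27 * B ^ 2 := by exact_mod_cast hAB
  have h := congrArg Complex.normSq hz
  have hn : Complex.normSq (A + s * B) = 4 * q := by
    rw [Complex.normSq_apply]
    simp [hre]
    linear_combination (B : ℝ) ^ 2 * him - hAB'
  rw [map_mul, map_mul, map_pow, hn, Complex.normSq_natCast] at h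
  have h3 : Complex.normSq z ^ 3 = (q : ℝ) ^ 3 := by
    rw [Complex.normSq_ofNat] at h
    linear_combination h / 4
  have hq1 : Complex.normSq z = q :=
    (pow_left_inj₀ (Complex.normSq_nonneg z) (Nat.cast_nonneg q) three_ne_zero).mp h3
  have hconj : (q : ℂ) / z = starRingEnd ℂ z := by
    rw [div_eq_iff hz0, mul_comm, Complex.mul_conj, hq1]
    simp
  rw [cubicEigenvalue, hconj, Complex.add_conj]
  push_cast
  ring

end Cardano

/-! ### Irrationality -/

theorem Int.eq_of_prime_pow_mul_eq {p : ℤ} (hp : Prime p) {i j : ℕ} {u w : ℤ} (hu : ¬ p ∣ u)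
    (hw : ¬ p ∣ w) (h : p ^ i * u = p ^ j * w) : i = j := by
  have := congrArg (emultiplicity p) h
  rw [emultiplicity_mul hp, emultiplicity_mul hp, emultiplicity_eq_zero.mpr hu,
    emultiplicity_eq_zero.mpr hw, add_zero, add_zero, emultiplicity_pow_self hp.ne_zero hp.not_isUnit,
    emultiplicity_pow_self hp.ne_zero hp.not_isUnit] at this
  exact_mod_cast this

/-- `X³ - 3 q X - q A` has no rational root if `q = p ^ m` with `3 ∤ m` and `p ∤ A`. -/
theorem irrational_of_cube_eq {p m : ℕ} (hp : p.Prime) (hm : ¬ 3 ∣ m) {A : ℤ}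
    (hA : ¬ (p : ℤ) ∣ A) {x : ℝ} (hx : x ^ 3 = (p : ℝ) ^ m * (3 * x + A)) : Irrational x := by
  rintro ⟨r, rfl⟩
  have hr : r ^ 3 = (p : ℚ) ^ m * (3 * r + A) := by exact_mod_cast hx
  have hint : IsIntegral ℤ r := by
    refine ⟨Polynomial.X ^ 3 - (Polynomial.C (3 * (p : ℤ) ^ m) * Polynomial.X +
      Polynomial.C ((p : ℤ) ^ m * A)), ?_, ?_⟩
    · monicity!
    · rw [← Polynomial.aeval_def]
      have h3 : Polynomial.aeval r (3 : Polynomial ℤ) = 3 := map_ofNat _ 3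
      simp [h3]
      linear_combination hr
  obtain ⟨y, rfl⟩ := IsIntegrallyClosed.isIntegral_iff.mp hint
  have hy : y ^ 3 = (p : ℤ) ^ m * (3 * y + A) := by
    simp only [eq_intCast] at hr
    exact_mod_cast hr
  have hp' : Prime (p : ℤ) := Nat.prime_iff_prime_int.mp hp
  have hm0 : m ≠ 0 := by rintro rfl; simp at hm
  -- A rational root is an integer `y` divisible by `p`, so `3 y + A` is prime to `p`. Then `y³` has
  -- valuation exactly `m`, contrary to `3 ∤ m`.
  have hpy : (p : ℤ) ∣ y :=
    hp'.dvd_of_dvd_pow (hy ▸ (dvd_pow_self _ hm0).mul_right _)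
  have hndvd : ¬ (p : ℤ) ∣ 3 * y + A := fun h =>
    hA ((dvd_add_right (hpy.mul_left 3)).mp h)
  have hy0 : y ≠ 0 := by
    rintro rfl
    rw [zero_pow three_ne_zero, eq_comm, mul_eq_zero] at hy
    rcases hy with h | h
    · exact pow_ne_zero _ hp'.ne_zero h
    · exact hndvd (by rw [h]; exact dvd_zero _)
  obtain ⟨v, w, hw, rfl⟩ := (FiniteMultiplicity.of_prime_left hp' hy0).exists_eq_pow_mul_and_not_dvd
    |> fun ⟨c, h, h'⟩ => (⟨_, c, h', h⟩ : ∃ v w, ¬ (p : ℤ) ∣ w ∧ y = (p : ℤ) ^ v * w)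
  rw [mul_pow, ← pow_mul] at hy
  have := Int.eq_of_prime_pow_mul_eq hp' (fun h => hw (hp'.dvd_of_dvd_pow h)) hndvd hy
  exact hm ⟨v, by omega⟩

/-! ### Undirectedness and connectedness -/

theorem gpGraph_isUndirected_of_odd (F : Type*) [Field F] {k : ℕ} (hk : Odd k) :
    (gpGraph k F).IsUndirected := by
  rintro u v ⟨x, hx, h⟩
  exact ⟨-x, neg_ne_zero.mpr hx, by rw [hk.neg_pow, ← h, neg_sub]⟩

namespace gpGraph

variable {F : Type*} [Field F]

theorem reflTransGen_add {k : ℕ} {u v : F} (h : Relation.ReflTransGen (gpGraph k F).Adj u v)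
    (w : F) : Relation.ReflTransGen (gpGraph k F).Adj (w + u) (w + v) :=
  h.lift (w + ·) fun a b ⟨x, hx, hab⟩ => ⟨x, hx, by rw [← hab]; ring⟩

theorem reflTransGen_mul {k : ℕ} {u v c : F} (hc : c ≠ 0)
    (h : Relation.ReflTransGen (gpGraph k F).Adj u v) :
    Relation.ReflTransGen (gpGraph k F).Adj (c ^ k * u) (c ^ k * v) :=
  h.lift (c ^ k * ·) fun a b ⟨x, hx, hab⟩ =>
    ⟨c * x, mul_ne_zero hc hx, by rw [mul_pow, ← hab]; ring⟩

/-- Along a path to `y`, an edge from `b` to `d` has `d - b = c³`. The path from `0` to `x`, scaled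
by `c³` and translated by `x b`, leads from `x b` to `x d`. -/
theorem reflTransGen_zero_mul {x y : F} (hx : Relation.ReflTransGen (gpGraph 3 F).Adj 0 x)
    (hy : Relation.ReflTransGen (gpGraph 3 F).Adj 0 y) :
    Relation.ReflTransGen (gpGraph 3 F).Adj 0 (x * y) := by
  induction hy with
  | refl => rw [mul_zero]
  | @tail b d _ hbd ih =>
    obtain ⟨c, hc, hbd⟩ := hbd
    have h := reflTransGen_add (reflTransGen_mul hc hx) (x * b)
    rw [mul_zero, add_zero, ← hbd, show x * b + (d - b) * x = x * d by ring] at h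
    exact ih.trans h

/-- The elements reachable from `0` form a subfield. -/
def reachable (F : Type*) [Field F] : Subfield F where
  carrier := {x | Relation.ReflTransGen (gpGraph 3 F).Adj 0 x}
  zero_mem' := .refl
  one_mem' := .single ⟨1, one_ne_zero, by simp⟩
  add_mem' := fun {x y} hx hy => by
    have := reflTransGen_add hy x
    rw [add_zero] at this
    exact hx.trans this
  neg_mem' := fun {x} hx => by
    have := reflTransGen_mul (c := -1) (neg_ne_zero.mpr one_ne_zero) hx
    rw [mul_zero] at this
    simpa [show (-1 : F) ^ 3 = -1 by ring] using this
  mul_mem' := reflTransGen_zero_mul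
  inv_mem' := fun x hx => by
    rcases eq_or_ne x 0 with rfl | h0
    · rw [inv_zero]; exact .refl
    -- The inverse is a cube times a reachable element: `x⁻¹ = (x⁻¹)³ x²`.
    · have h := reflTransGen_mul (inv_ne_zero h0) (reflTransGen_zero_mul hx hx)
      rw [mul_zero] at h
      rwa [show x⁻¹ ^ 3 * (x * x) = x⁻¹ by field_simp] at h

end gpGraph

/-- The subfield of reachable elements contains `0` and the `n` nonzero cubes, so its order `r`
satisfies `3 r ≥ q + 2`. If it were proper, then `r² ≤ q`, whence `r² + 2 ≤ 3 r`, `r ≤ 2` and `q ≤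
4`. -/
theorem gpGraph_three_isStronglyConnected {F : Type*} [Field F] [Fintype F]
    (h5 : 5 ≤ Fintype.card F) (h3 : 3 ∣ Fintype.card F - 1) :
    (gpGraph 3 F).IsStronglyConnected := by
  classical
  refine ⟨⟨0⟩, ?_⟩
  have htop : gpGraph.reachable F = ⊤ := by
    obtain ⟨χ, hχ⟩ := MulChar.exists_mulChar_orderOf F h3 zeta3_isPrimitiveRoot
    have hχ3 : χ ^ 3 = 1 := hχ ▸ pow_orderOf_eq_one χ
    have hχ1 : χ ≠ 1 := by
      rintro rfl
      rw [orderOf_one] at hχ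
      norm_num at hχ
    have hcard := MulChar.card_cubic_fiber hχ3 hχ1 (one_pow 3)
    have hsub : insert 0 ({a : F | a ≠ 0 ∧ χ a = 1} : Finset F) ⊆
        (gpGraph.reachable F : Set F).toFinset := by
      intro a ha
      rw [Set.mem_toFinset]
      rcases Finset.mem_insert.mp ha with rfl | ha
      · exact zero_mem (gpGraph.reachable F)
      · obtain ⟨h0, h1⟩ := (Finset.mem_filter.mp ha).2
        obtain ⟨x, hx, rfl⟩ := (MulChar.cubic_apply_eq_one_iff hχ3 hχ1 h0).mp h1
        exact Relation.ReflTransGen.single ⟨x, hx, sub_zero _⟩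
    have hle := Finset.card_le_card hsub
    rw [Finset.card_insert_of_notMem (by simp), hcard, Set.toFinset_card] at hle
    have hpow := Module.card_eq_pow_finrank (K := gpGraph.reachable F) (V := F)
    change _ ≤ Fintype.card (gpGraph.reachable F) at hle
    set r := Fintype.card (gpGraph.reachable F) with hr
    set d := Module.finrank (gpGraph.reachable F) F with hd
    have hd1 : d = 1 := by
      by_contra hd1
      rcases Nat.lt_or_ge d 2 with h | h
      · have : d = 0 := by omega
        rw [this, pow_zero] at hpow
        omega
      · have hr0 : 0 < r := Fintype.card_pos
        have h2 : r ^ 2 ≤ Fintype.card F := hpow ▸ Nat.pow_le_pow_right hr0 h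
        have h3r : Fintype.card F + 2 ≤ 3 * r := by omega
        have : r ≤ 2 := by
          by_contra! hr3
          nlinarith
        omega
    rw [hd1, pow_one] at hpow
    have huniv : (gpGraph.reachable F : Set F).toFinset = Finset.univ := by
      rw [← Finset.card_eq_iff_eq_univ, Set.toFinset_card, hpow]
      rfl
    rw [eq_top_iff]
    intro x _
    have := huniv ▸ Finset.mem_univ x
    simpa using this
  intro u v
  have h : v - u ∈ gpGraph.reachable F := htop ▸ Subfield.mem_top _
  have := gpGraph.reflTransGen_add (show Relation.ReflTransGen _ _ _ from h) u
  rwa [add_zero, add_sub_cancel] at this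

/-! ### Spectra for `p ≡ 1` and `p ≡ 2 (mod 3)` -/

theorem isRep27_natPow_iff {p k : ℕ} (hp : p.Prime) {a b : ℤ} :
    IsRep27 p ((p : ℝ) ^ k) a b ↔
      4 * (p : ℤ) ^ k = a ^ 2 + 27 * b ^ 2 ∧ a ≡ 1 [ZMOD 3] ∧ ¬ (p : ℤ) ∣ a := by
  rw [IsRep27, isCoprime_comm, (Nat.prime_iff_prime_int.mp hp).coprime_iff_not_dvd]
  norm_cast

/-- Existence comes from a Jacobi sum over a field with `p ^ k` elements. When `3 ∣ m` this is
applied with `k = m / 3`, which is why an auxiliary field is used. -/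
theorem existsUniqueRep27_natPow {p k : ℕ} (hp : p.Prime) (h1 : p % 3 = 1) (hk : k ≠ 0) :
    ExistsUniqueRep27 p ((p : ℝ) ^ k) := by
  have := Fact.mk hp
  let := Fintype.ofFinite (GaloisField p k)
  have hcard : Fintype.card (GaloisField p k) = p ^ k := by
    rw [← Nat.card_eq_fintype_card, GaloisField.card p k hk]
  have h3 : 3 ∣ Fintype.card (GaloisField p k) - 1 := by
    have : p ^ k % 3 = 1 := by simp [Nat.pow_mod, h1]
    omega
  obtain ⟨-, A, B, -, -, -, hAB, hA, hpA, -⟩ := exists_cubic_jacobiSum _ hp hcard h3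
  refine ⟨A, B, (isRep27_natPow_iff hp).mpr ⟨hAB, hA, hpA h1⟩, fun a b hab => ?_⟩
  obtain ⟨hab, ha, hpa⟩ := (isRep27_natPow_iff hp).mp hab
  exact Int.sq_add_twentySeven_mul_sq_unique hp (by omega) hAB hab hA ha (hpA h1) hpa

theorem right_ne_zero_of_sq_add_twentySeven_mul_sq {p m : ℕ} (hp : p.Prime) (hm : m ≠ 0) {A B : ℤ}
    (hAB : 4 * (p : ℤ) ^ m = A ^ 2 + 27 * B ^ 2) (hA : ¬ (p : ℤ) ∣ A) : B ≠ 0 := by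
  rintro rfl
  refine hA ((Nat.prime_iff_prime_int.mp hp).dvd_of_dvd_pow (n := 2) ?_)
  rw [show A ^ 2 = 4 * (p : ℤ) ^ m by linear_combination -hAB]
  exact (dvd_pow_self _ hm).mul_left _

/-- The spectrum of `Γ(3, q)` for `p ≡ 1 (mod 3)`. -/
theorem gpGraph_three_hasSpec {F : Type*} [Field F] [Fintype F] {p m : ℕ} (hp : p.Prime)
    (h1 : p % 3 = 1) (hF : Fintype.card F = p ^ m) (h5 : 5 ≤ p ^ m) (h3q : 3 ∣ p ^ m - 1)
    {A B : ℤ} (hAB : 4 * (p : ℤ) ^ m = A ^ 2 + 27 * B ^ 2) (hA : A ≡ 1 [ZMOD 3])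
    (hpA : ¬ (p : ℤ) ∣ A) {s z : ℂ} (hs : s ^ 2 = -27)
    (hz : 2 * z ^ 3 = (p : ℂ) ^ m * (A + s * B)) :
    (gpGraph 3 F).HasSpec
      [((((p ^ m - 1) / 3 : ℕ) : ℂ), 1), (cubicEigenvalue (p ^ m) z, (p ^ m - 1) / 3),
        (cubicEigenvalue (p ^ m) (zeta3 * z), (p ^ m - 1) / 3),
        (cubicEigenvalue (p ^ m) (zeta3 ^ 2 * z), (p ^ m - 1) / 3)] := by
  have hm : m ≠ 0 := by
    rintro rfl
    norm_num at h5
  have hspec : (gpGraph 3 F).spec = (((p ^ m - 1) / 3 : ℕ) : ℂ) ::ₘ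
      cubicEigenvalues (p ^ m) ((p ^ m - 1) / 3) z := by
    obtain ⟨A', B', hAB', hA', hpA', -, h⟩ := exists_rep_gpGraph_three_spec F hp hF (hF ▸ h3q)
    obtain ⟨rfl, hB⟩ := Int.sq_add_twentySeven_mul_sq_unique hp (by omega) hAB hAB' hA hA' hpA
      (hpA' h1)
    -- The sign of `B` is absorbed by replacing `s` with `-s`.
    rcases hB with rfl | rfl
    · exact h s z hs hz
    · exact h (-s) z (by rw [neg_sq, hs]) (by rw [hz]; push_cast; ring)
  have hB := right_ne_zero_of_sq_add_twentySeven_mul_sq hp hm hAB hpA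
  have hA0 : A ≠ 0 := by rintro rfl; exact hpA (dvd_zero _)
  have hq0 : p ^ m ≠ 0 := by omega
  have hABq : 4 * ((p ^ m : ℕ) : ℤ) = A ^ 2 + 27 * B ^ 2 := by push_cast; exact hAB
  have hzq : 2 * z ^ 3 = ((p ^ m : ℕ) : ℂ) * (A + s * B) := by push_cast; exact hz
  have hz0 := ne_zero_of_two_mul_cube_eq hq0 hABq hs hzq
  have hc1 : (zeta3 * z) ^ 3 = z ^ 3 := by rw [mul_pow, zeta3_cube, one_mul]
  have hc2 : (zeta3 ^ 2 * z) ^ 3 = z ^ 3 := by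
    linear_combination (zeta3 ^ 3 + 1) * z ^ 3 * zeta3_cube
  have hζ1 : zeta3 ≠ 1 := zeta3_isPrimitiveRoot.ne_one (by norm_num)
  have hζ2 : zeta3 ^ 2 ≠ 1 :=
    zeta3_isPrimitiveRoot.pow_ne_one_of_pos_of_lt two_ne_zero (by norm_num)
  have e1 : cubicEigenvalue (p ^ m) z ≠ cubicEigenvalue (p ^ m) (zeta3 * z) := fun h =>
    hζ1 (mul_right_cancel₀ hz0
      (by rw [one_mul]; exact (eq_of_cubicEigenvalue_eq hq0 hA0 hB hABq hs hzq hc1 h).symm))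
  have e2 : cubicEigenvalue (p ^ m) z ≠ cubicEigenvalue (p ^ m) (zeta3 ^ 2 * z) := fun h =>
    hζ2 (mul_right_cancel₀ hz0
      (by rw [one_mul]; exact (eq_of_cubicEigenvalue_eq hq0 hA0 hB hABq hs hzq hc2 h).symm))
  have e3 : cubicEigenvalue (p ^ m) (zeta3 * z) ≠ cubicEigenvalue (p ^ m) (zeta3 ^ 2 * z) := by
    intro h
    have := eq_of_cubicEigenvalue_eq hq0 hA0 hB hABq hs (by rw [hc1]; exact hzq)
      (hc2.trans hc1.symm) h
    refine hζ1 (mul_left_cancel₀ (mul_ne_zero zeta3_ne_zero hz0) ?_)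
    linear_combination -this
  have n1 := cubicEigenvalue_ne h5 h3q hABq hs hzq
  have n2 := cubicEigenvalue_ne (z := zeta3 * z) h5 h3q hABq hs (by rw [hc1]; exact hzq)
  have n3 := cubicEigenvalue_ne (z := zeta3 ^ 2 * z) h5 h3q hABq hs (by rw [hc2]; exact hzq)
  refine ⟨by simp [e1, e2, e3, n1, n2, n3], ?_⟩
  rw [hspec, cubicEigenvalues]
  simp [add_assoc]

/-- The eigenvalues of `Γ(3, q)` for `p ≡ 2 (mod 3)`, where `q = r²` and `e = ± 1`. -/
theorem gpGraph_three_spec_of_semiprimitive {F : Type*} [Field F] [Fintype F] {p h : ℕ}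
    (hp : p.Prime) (h2 : p % 3 = 2) (hF : Fintype.card F = (p ^ h) ^ 2) (h5 : 5 ≤ (p ^ h) ^ 2)
    (h3q : 3 ∣ (p ^ h) ^ 2 - 1) {e : ℤ} (he : e = 1 ∨ e = -1) (her : e * p ^ h ≡ 2 [ZMOD 3]) :
    (gpGraph 3 F).spec = (((((p ^ h) ^ 2 - 1) / 3 : ℕ) : ℂ)) ::ₘ
      (Multiset.replicate (((p ^ h) ^ 2 - 1) / 3) ((2 * (e * (p : ℂ) ^ h) - 1) / 3) +
        Multiset.replicate (2 * (((p ^ h) ^ 2 - 1) / 3)) ((-(e * (p : ℂ) ^ h) - 1) / 3)) ∧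
    ((((p ^ h) ^ 2 - 1) / 3 : ℕ) : ℂ) ≠ (2 * (e * (p : ℂ) ^ h) - 1) / 3 ∧
    ((((p ^ h) ^ 2 - 1) / 3 : ℕ) : ℂ) ≠ (-(e * (p : ℂ) ^ h) - 1) / 3 ∧
    (2 * (e * (p : ℂ) ^ h) - 1) / 3 ≠ (-(e * (p : ℂ) ^ h) - 1) / 3 := by
  rw [← pow_mul] at hF h5 h3q
  obtain ⟨A, B, hAB, hA, -, hB, H⟩ := exists_rep_gpGraph_three_spec F hp hF (hF ▸ h3q)
  obtain rfl := hB h2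
  have hee : e ^ 2 = 1 := by rcases he with rfl | rfl <;> norm_num
  -- As `B = 0`, `A² = 4 q`; the condition `A ≡ 1 (mod 3)` selects the sign.
  have hA' : A = 2 * (e * (p : ℤ) ^ h) := by
    have hsq : A ^ 2 = (2 * (e * (p : ℤ) ^ h)) ^ 2 := by
      rw [pow_mul] at hAB
      linear_combination -hAB - 4 * ((p : ℤ) ^ h) ^ 2 * hee
    rw [Int.ModEq] at hA her
    rcases sq_eq_sq_iff_eq_or_eq_neg.mp hsq with h | h <;> omega
  have heC : (e : ℂ) ^ 2 = 1 := by exact_mod_cast hee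
  set z : ℂ := e * (p : ℂ) ^ h with hzdef
  have hzz : z * z = ((p ^ (h * 2) : ℕ) : ℂ) := by
    push_cast
    rw [hzdef, pow_mul]
    linear_combination ((p : ℂ) ^ h) ^ 2 * heC
  have hq0 : p ^ (h * 2) ≠ 0 := by omega
  have hz0 : z ≠ 0 := by
    intro h0
    rw [h0, zero_mul] at hzz
    exact hq0 (by exact_mod_cast hzz.symm)
  have hw : (3 * (2 * zeta3 + 1)) ^ 2 = -27 := by linear_combination 36 * zeta3_sq
  have hz : 2 * z ^ 3 = ((p ^ (h * 2) : ℕ) : ℂ) *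
      (A + (3 * (2 * zeta3 + 1)) * ((0 : ℤ) : ℂ)) := by
    rw [hA', ← hzz]
    push_cast
    rw [← hzdef]
    ring
  have hABq : 4 * ((p ^ (h * 2) : ℕ) : ℤ) = A ^ 2 + 27 * 0 ^ 2 := by push_cast; exact hAB
  have hc1 : (zeta3 * z) ^ 3 = z ^ 3 := by rw [mul_pow, zeta3_cube, one_mul]
  have hc2 : (zeta3 ^ 2 * z) ^ 3 = z ^ 3 := by
    linear_combination (zeta3 ^ 3 + 1) * z ^ 3 * zeta3_cube
  have hζ0 := zeta3_ne_zero
  -- Here `z² = q`, so `z + q / z = 2 z`, while both other roots give `(ω + ω²) z = -z`.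
  have v0 : cubicEigenvalue (p ^ (h * 2)) z = (2 * z - 1) / 3 := by
    rw [cubicEigenvalue, ← hzz]
    field_simp
    ring
  have v1 : cubicEigenvalue (p ^ (h * 2)) (zeta3 * z) = (-z - 1) / 3 := by
    rw [cubicEigenvalue, ← hzz]
    field_simp
    linear_combination z * zeta3_sq
  have v2 : cubicEigenvalue (p ^ (h * 2)) (zeta3 ^ 2 * z) = (-z - 1) / 3 := by
    rw [cubicEigenvalue, ← hzz]
    field_simp
    linear_combination z * (zeta3 ^ 2 - zeta3 + 1) * zeta3_sq
  have n1 := cubicEigenvalue_ne h5 h3q hABq hw hz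
  have n2 := cubicEigenvalue_ne (z := zeta3 * z) h5 h3q hABq hw (by rw [hc1]; exact hz)
  have hspec := H _ z hw (by rw [hz]; push_cast; rfl)
  rw [cubicEigenvalues, v0, v1, v2] at hspec
  rw [v0] at n1
  rw [v1] at n2
  rw [← pow_mul]
  refine ⟨?_, n1, n2, ?_⟩
  · rw [hspec, two_mul (_ / 3), Multiset.replicate_add, add_assoc]
  · intro h
    apply hz0
    linear_combination h

/-! ### Explicit eigenvalues when `q` is a cube -/

theorem natPow_rpow_div {p k d : ℕ} (hd : d ≠ 0) :
    ((p ^ (d * k) : ℕ) : ℝ) ^ (1 / (d : ℝ)) = (p : ℝ) ^ k := by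
  rw [mul_comm, pow_mul, Nat.cast_pow, one_div, Real.pow_rpow_inv_natCast (by positivity) hd]
  push_cast
  rfl

theorem Int.exists_eq_add_two_mul_of_rep {N a b : ℤ} (hab : 4 * N = a ^ 2 + 27 * b ^ 2) :
    ∃ c, a = b + 2 * c := by
  have h : Even (a ^ 2 + 27 * b ^ 2) := hab ▸ ⟨2 * N, by ring⟩
  have : Even (a - b) := by
    simp only [Int.even_add, Int.even_sub, Int.even_mul, Int.even_pow] at h ⊢
    have h27 : ¬ Even (27 : ℤ) := by decide
    tauto
  obtain ⟨c, hc⟩ := this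
  exact ⟨c, by omega⟩

/-- The cube of `(a + b √-27) / 2` is again of this form. -/
theorem exists_cube_rep {p k : ℕ} (hp : p.Prime) (hp2 : p ≠ 2) (hk : k ≠ 0) {a b : ℤ}
    (hab : 4 * (p : ℤ) ^ k = a ^ 2 + 27 * b ^ 2) (ha : a ≡ 1 [ZMOD 3]) (hpa : ¬ (p : ℤ) ∣ a) :
    ∃ A B : ℤ, 4 * A = a ^ 3 - 81 * a * b ^ 2 ∧ 4 * B = 3 * a ^ 2 * b - 27 * b ^ 3 ∧
      4 * (p : ℤ) ^ (3 * k) = A ^ 2 + 27 * B ^ 2 ∧ A ≡ 1 [ZMOD 3] ∧ ¬ (p : ℤ) ∣ A := by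
  obtain ⟨c, rfl⟩ := Int.exists_eq_add_two_mul_of_rep hab
  -- With `a = b + 2 c` the real and imaginary parts of the cube become divisible by `4`; the
  -- witnesses are the expanded quotients.
  have hA : ∃ A, 4 * A = (b + 2 * c) ^ 3 - 81 * (b + 2 * c) * b ^ 2 :=
    ⟨-20 * b ^ 3 - 39 * b ^ 2 * c + 3 * b * c ^ 2 + 2 * c ^ 3, by ring⟩
  have hB : ∃ B, 4 * B = 3 * (b + 2 * c) ^ 2 * b - 27 * b ^ 3 :=
    ⟨-6 * b ^ 3 + 3 * b ^ 2 * c + 3 * b * c ^ 2, by ring⟩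
  generalize b + 2 * c = a at *
  obtain ⟨A, hA⟩ := hA
  obtain ⟨B, hB⟩ := hB
  refine ⟨A, B, hA, hB, ?_, ?_, ?_⟩
  · have h3 : 64 * (p : ℤ) ^ (3 * k) = (a ^ 2 + 27 * b ^ 2) ^ 3 := by
      rw [← hab, mul_comm 3 k, pow_mul]
      ring
    have : 16 * (4 * (p : ℤ) ^ (3 * k)) = 16 * (A ^ 2 + 27 * B ^ 2) := by
      linear_combination h3 - (4 * A + (a ^ 3 - 81 * a * b ^ 2)) * hA
        - 27 * (4 * B + (3 * a ^ 2 * b - 27 * b ^ 3)) * hB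
    omega
  · have h1 : a ^ 3 ≡ 1 [ZMOD 3] := by simpa using ha.pow 3
    rw [Int.ModEq] at h1 ⊢
    have h81 : a ^ 3 - 81 * a * b ^ 2 = a ^ 3 - 3 * (27 * a * b ^ 2) := by ring
    omega
  · intro hdvd
    have hp' : Prime (p : ℤ) := Nat.prime_iff_prime_int.mp hp
    -- Eliminating `b²` gives `4 a³ = 4 A + 12 a p ^ k`, so `p ∣ A` would imply `p ∣ a`.
    have h : (p : ℤ) ∣ 2 * (2 * a ^ 3) := by
      have : 2 * (2 * a ^ 3) = 4 * A + 12 * a * (p : ℤ) ^ k - (4 * A - (a ^ 3 - 81 * a * b ^ 2))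
        := by linear_combination -3 * a * hab
      rw [hA, sub_self, sub_zero, ← hA] at this
      rw [this]
      exact dvd_add (hdvd.mul_left _) ((dvd_pow_self _ hk).mul_left _)
    have hp2' : ¬ (p : ℤ) ∣ 2 := by
      intro h
      exact hp2 ((Nat.prime_dvd_prime_iff_eq hp Nat.prime_two).mp (by exact_mod_cast h))
    exact hpa (hp'.dvd_of_dvd_pow
      ((hp'.dvd_or_dvd ((hp'.dvd_or_dvd h).resolve_left hp2')).resolve_left hp2'))

theorem cubicEigenvalue_of_mul_eq {q : ℕ} {z w : ℂ} (hz : z ≠ 0) (h : z * w = q) :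
    cubicEigenvalue q z = (z + w - 1) / 3 := by
  rw [cubicEigenvalue, ← h, mul_div_cancel_left₀ _ hz]

theorem exists_irrational_cubicEigenvalue_eq {p m : ℕ} (hp : p.Prime) (hm : ¬ 3 ∣ m) {A B : ℤ}
    (hAB : 4 * (p : ℤ) ^ m = A ^ 2 + 27 * B ^ 2) (hpA : ¬ (p : ℤ) ∣ A) {s z : ℂ}
    (hs : s ^ 2 = -27) (hz : 2 * z ^ 3 = (p : ℂ) ^ m * (A + s * B)) :
    ∃ r : ℝ, Irrational r ∧ cubicEigenvalue (p ^ m) z = r := by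
  have hq0 : p ^ m ≠ 0 := pow_ne_zero m hp.ne_zero
  have hABq : 4 * ((p ^ m : ℕ) : ℤ) = A ^ 2 + 27 * B ^ 2 := by push_cast; exact hAB
  have hzq : 2 * z ^ 3 = ((p ^ m : ℕ) : ℂ) * (A + s * B) := by push_cast; exact hz
  have hreal := cubicEigenvalue_eq_ofReal hq0 hABq hs hzq
  refine ⟨_, ?_, hreal⟩
  have hx : z + (p ^ m : ℕ) / z = ((2 * z.re : ℝ) : ℂ) := by
    rw [cubicEigenvalue] at hreal
    push_cast at hreal ⊢
    linear_combination 3 * hreal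
  have hc := add_div_cube_eq hq0 hABq hs hzq
  rw [hx] at hc
  have hc' : (2 * z.re) ^ 3 = (p : ℝ) ^ m * (3 * (2 * z.re) + A) := by exact_mod_cast hc
  have hirr := irrational_of_cube_eq hp hm hpA hc'
  rintro ⟨r, hr⟩
  exact hirr ⟨3 * r + 1, by push_cast; linarith⟩

/-- The case `p ≡ 1 (mod 3)`, `q = (p ^ k) ^ 3`. -/
theorem gpGraph_three_hasSpec_cube {F : Type*} [Field F] [Fintype F] {p k : ℕ} (hp : p.Prime)
    (h1 : p % 3 = 1) (hF : Fintype.card F = p ^ (3 * k)) (h5 : 5 ≤ p ^ (3 * k))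
    (h3q : 3 ∣ p ^ (3 * k) - 1) {a b : ℤ} (hab : 4 * (p : ℤ) ^ k = a ^ 2 + 27 * b ^ 2)
    (ha : a ≡ 1 [ZMOD 3]) (hpa : ¬ (p : ℤ) ∣ a) :
    (gpGraph 3 F).HasSpec
      [((((p ^ (3 * k) - 1) / 3 : ℕ) : ℂ), 1),
        (((((a : ℝ) * (p : ℝ) ^ k - 1) / 3 : ℝ) : ℂ), (p ^ (3 * k) - 1) / 3),
        (((((-(1 / 2) * ((a : ℝ) + 9 * b)) * (p : ℝ) ^ k - 1) / 3 : ℝ) : ℂ),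
          (p ^ (3 * k) - 1) / 3),
        (((((-(1 / 2) * ((a : ℝ) - 9 * b)) * (p : ℝ) ^ k - 1) / 3 : ℝ) : ℂ),
          (p ^ (3 * k) - 1) / 3)] := by
  have hk : k ≠ 0 := by
    rintro rfl
    norm_num at h5
  obtain ⟨A, B, hA, hB, hAB, hA1, hpA⟩ := exists_cube_rep hp (by omega) hk hab ha hpa
  have hs : (3 * (2 * zeta3 + 1)) ^ 2 = -27 := by linear_combination 36 * zeta3_sq
  have hAC : 4 * (A : ℂ) = a ^ 3 - 81 * a * b ^ 2 := by exact_mod_cast hA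
  have hBC : 4 * (B : ℂ) = 3 * a ^ 2 * b - 27 * b ^ 3 := by exact_mod_cast hB
  have habC : 4 * (p : ℂ) ^ k = a ^ 2 + 27 * b ^ 2 := by exact_mod_cast hab
  set s : ℂ := 3 * (2 * zeta3 + 1) with hsdef
  set R : ℂ := (p : ℂ) ^ k with hR
  have hq : ((p ^ (3 * k) : ℕ) : ℂ) = R ^ 3 := by
    push_cast
    rw [hR, mul_comm, pow_mul]
  have hR0 : R ≠ 0 := pow_ne_zero _ (Nat.cast_ne_zero.mpr hp.ne_zero)
  have hz : 2 * (R * (a + s * b) / 2) ^ 3 = (p : ℂ) ^ (3 * k) * (A + s * B) := by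
    rw [mul_comm 3 k, pow_mul, ← hR]
    linear_combination -(R ^ 3 / 4) * hAC - (R ^ 3 / 4) * s * hBC +
      R ^ 3 / 4 * (3 * a * b ^ 2 + s * b ^ 3) * hs
  have hmul : (R * (a + s * b) / 2) * (R * (a - s * b) / 2) = ((p ^ (3 * k) : ℕ) : ℂ) := by
    rw [hq]
    linear_combination -(R ^ 2 / 4) * habC - (R ^ 2 / 4) * b ^ 2 * hs
  have hz0 : R * (a + s * b) / 2 ≠ 0 := by
    intro h
    rw [h, zero_mul, hq] at hmul
    exact pow_ne_zero 3 hR0 hmul.symm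
  have v0 : cubicEigenvalue (p ^ (3 * k)) (R * (a + s * b) / 2) =
      ((((a : ℝ) * (p : ℝ) ^ k - 1) / 3 : ℝ) : ℂ) := by
    rw [cubicEigenvalue_of_mul_eq hz0 hmul]
    push_cast
    rw [← hR]
    ring
  -- The `b`-term carries the factor `(ω - ω²) s / 2 = 3 (2 ω + 1)² / 2 = -9 / 2`.
  have v1 : cubicEigenvalue (p ^ (3 * k)) (zeta3 * (R * (a + s * b) / 2)) =
      ((((-(1 / 2) * ((a : ℝ) + 9 * b)) * (p : ℝ) ^ k - 1) / 3 : ℝ) : ℂ) := by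
    rw [cubicEigenvalue_of_mul_eq (w := zeta3 ^ 2 * (R * (a - s * b) / 2))
      (mul_ne_zero zeta3_ne_zero hz0) (by linear_combination hmul + (R * (a + s * b) / 2) *
        (R * (a - s * b) / 2) * zeta3_cube)]
    push_cast
    rw [← hR, hsdef]
    linear_combination (R * a / 6 + R * b * (- 2 * zeta3 + 3) / 2) * zeta3_sq
  have v2 : cubicEigenvalue (p ^ (3 * k)) (zeta3 ^ 2 * (R * (a + s * b) / 2)) =
      ((((-(1 / 2) * ((a : ℝ) - 9 * b)) * (p : ℝ) ^ k - 1) / 3 : ℝ) : ℂ) := by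
    rw [cubicEigenvalue_of_mul_eq (w := zeta3 * (R * (a - s * b) / 2))
      (mul_ne_zero (pow_ne_zero 2 zeta3_ne_zero) hz0) (by linear_combination hmul +
        (R * (a + s * b) / 2) * (R * (a - s * b) / 2) * zeta3_cube)]
    push_cast
    rw [← hR, hsdef]
    linear_combination (R * a / 6 - R * b * (- 2 * zeta3 + 3) / 2) * zeta3_sq
  have := gpGraph_three_hasSpec hp h1 hF h5 h3q hAB hA1 hpA hs hz
  rwa [v0, v1, v2] at this

/-- Since `a` and `b` have the same parity, `-(a ± 9 b) / 2` are integers, and they are `≡ a ≡ 1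
(mod 3)` because `-2 ≡ 1`. As also `p ^ k ≡ 1`, each numerator is divisible by `3`. -/
theorem exists_intCast_cubic_values {p k : ℕ} (h1 : p % 3 = 1) {a b : ℤ}
    (hab : 4 * (p : ℤ) ^ k = a ^ 2 + 27 * b ^ 2) (ha : a ≡ 1 [ZMOD 3]) :
    (∃ t : ℤ, ((((a : ℝ) * (p : ℝ) ^ k - 1) / 3 : ℝ) : ℂ) = t) ∧
    (∃ t : ℤ, ((((-(1 / 2) * ((a : ℝ) + 9 * b)) * (p : ℝ) ^ k - 1) / 3 : ℝ) : ℂ) = t) ∧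
    (∃ t : ℤ, ((((-(1 / 2) * ((a : ℝ) - 9 * b)) * (p : ℝ) ^ k - 1) / 3 : ℝ) : ℂ) = t) := by
  have hp : (p : ℤ) ^ k ≡ 1 [ZMOD 3] := by
    have : (p : ℤ) ≡ 1 [ZMOD 3] := by
      rw [Int.ModEq]; omega
    simpa using this.pow k
  have key : ∀ x : ℤ, x ≡ 1 [ZMOD 3] →
      ∃ t : ℤ, (((x : ℝ) * (p : ℝ) ^ k - 1) / 3 : ℝ) = t := by
    intro x hx
    obtain ⟨t, ht⟩ := ((hx.mul hp).symm).dvd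
    refine ⟨t, ?_⟩
    have ht' : (x : ℝ) * (p : ℝ) ^ k - 1 * 1 = 3 * t := by exact_mod_cast ht
    linear_combination ht' / 3
  obtain ⟨c, rfl⟩ := Int.exists_eq_add_two_mul_of_rep hab
  have ha' := ha
  rw [Int.ModEq] at ha'
  refine ⟨?_, ?_, ?_⟩
  · obtain ⟨t, ht⟩ := key _ ha
    exact ⟨t, by rw [ht]; simp⟩
  -- With `a = b + 2 c`, `-(a + 9 b) / 2 = -(5 b + c)`; similarly `-(a - 9 b) / 2 = 4 b - c` in the
  -- last case.
  · obtain ⟨t, ht⟩ := key (-(5 * b + c)) (by rw [Int.ModEq]; omega)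
    refine ⟨t, ?_⟩
    rw [← Complex.ofReal_intCast, ← ht]
    push_cast
    ring
  · obtain ⟨t, ht⟩ := key (4 * b - c) (by rw [Int.ModEq]; omega)
    refine ⟨t, ?_⟩
    rw [← Complex.ofReal_intCast, ← ht]
    push_cast
    ring

/-! ### Cardano's formula and the main theorem -/

/-- Cardano's `W` is `-z`, in accordance with the `-a` under its cube root. -/
theorem cardanoRoot_eq (q : ℕ) (W : ℂ) (j : ℕ) :
    cardanoRoot q W j = cubicEigenvalue q (zeta3 ^ j * -W) := by
  rw [cardanoRoot, cubicEigenvalue, ← zeta3, mul_neg, div_neg]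
  ring

/-- For real `w` the left side is real, whereas the right side has imaginary part `q B Im s`, which
is nonzero. -/
theorem im_ne_zero_of_two_mul_cube_eq {q : ℕ} (hq : q ≠ 0) {A B : ℤ} (hB : B ≠ 0) {s w : ℂ}
    (hs : s ^ 2 = -27) (hw : 2 * w ^ 3 = q * (A + s * B)) : w.im ≠ 0 := by
  intro h
  obtain ⟨hre, him⟩ := Complex.re_eq_zero_of_sq_eq hs
  have hw' : w = (w.re : ℂ) := Complex.ext rfl (by simp [h])
  rw [hw'] at hw
  have := congrArg Complex.im hw
  have hl : (2 * (w.re : ℂ) ^ 3) = ((2 * w.re ^ 3 : ℝ) : ℂ) := by push_cast; rfl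
  rw [hl, Complex.ofReal_im] at this
  simp [hq, hB] at this
  rw [this] at him
  norm_num at him

theorem theorem3p1 (p m q n : ℕ) (hp : p.Prime) (hq : q = p ^ m) (hq5 : 5 ≤ q)
    (h3 : 3 ∣ q - 1) (hn : n = (q - 1) / 3)
    (F : Type*) [Field F] [Fintype F] (hF : Fintype.card F = q) :
    (gpGraph 3 F).IsStronglyConnected ∧ (gpGraph 3 F).IsUndirected ∧
    -- case (a)
    (p ≡ 1 [MOD 3] → 3 ∣ m →
      ExistsUniqueRep27 p ((q : ℝ) ^ (1 / 3 : ℝ)) ∧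
      (∀ a b : ℤ, IsRep27 p ((q : ℝ) ^ (1 / 3 : ℝ)) a b →
        (gpGraph 3 F).HasSpec
          [((n : ℂ), 1),
           (((((a : ℝ) * (q : ℝ) ^ (1 / 3 : ℝ) - 1) / 3 : ℝ) : ℂ), n),
           (((((-(1 / 2) * ((a : ℝ) + 9 * b)) * (q : ℝ) ^ (1 / 3 : ℝ) - 1) / 3 : ℝ) : ℂ), n),
           (((((-(1 / 2) * ((a : ℝ) - 9 * b)) * (q : ℝ) ^ (1 / 3 : ℝ) - 1) / 3 : ℝ) : ℂ), n)]) ∧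
      (∀ l ∈ (gpGraph 3 F).spec, ∃ z : ℤ, l = z)) ∧
    -- case (b)
    (p ≡ 1 [MOD 3] → ¬ 3 ∣ m →
      ExistsUniqueRep27 p (q : ℝ) ∧
      -- `s`, `c`, `d` are arbitrary roots `√(-27)`, `∛q`, `∛((-a + √(-27) b) / 2)`; `W = c * d`
      (∀ a b : ℤ, IsRep27 p (q : ℝ) a b →
        ∀ s c d : ℂ, s ^ 2 = -27 → c ^ 3 = (q : ℂ) → d ^ 3 = (1 / 2) * (-(a : ℂ) + s * b) →
          (∀ j : ℕ, (Complex.exp (2 * Real.pi * Complex.I / 3) ^ j * (c * d)).im ≠ 0) ∧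
          (gpGraph 3 F).HasSpec
            [((n : ℂ), 1),
             (cardanoRoot q (c * d) 0, n),
             (cardanoRoot q (c * d) 1, n),
             (cardanoRoot q (c * d) 2, n)]) ∧
      (∀ l ∈ (gpGraph 3 F).spec, l ≠ (n : ℂ) → ∃ r : ℝ, Irrational r ∧ l = r)) ∧
    -- case (c)
    (p ≡ 2 [MOD 3] → Even m →
      (m ≡ 0 [MOD 4] →
        (gpGraph 3 F).HasSpec
          [((n : ℂ), 1),
           ((((Real.sqrt q - 1) / 3 : ℝ) : ℂ), 2 * n),
           ((((-2 * Real.sqrt q - 1) / 3 : ℝ) : ℂ), n)]) ∧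
      (m ≡ 2 [MOD 4] →
        (gpGraph 3 F).HasSpec
          [((n : ℂ), 1),
           ((((2 * Real.sqrt q - 1) / 3 : ℝ) : ℂ), n),
           ((((-Real.sqrt q - 1) / 3 : ℝ) : ℂ), 2 * n)]) ∧
      (∀ l ∈ (gpGraph 3 F).spec, ∃ z : ℤ, l = z)) := by
  subst hq hn
  refine ⟨gpGraph_three_isStronglyConnected (hF ▸ hq5) (hF ▸ h3),
    gpGraph_isUndirected_of_odd F (by decide), ?_, ?_, ?_⟩
  · rintro h1 ⟨k, rfl⟩
    have h1 : p % 3 = 1 := h1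
    have hk : k ≠ 0 := by
      rintro rfl
      norm_num at hq5
    have hR : ((p ^ (3 * k) : ℕ) : ℝ) ^ (1 / 3 : ℝ) = (p : ℝ) ^ k := by
      have := natPow_rpow_div (p := p) (k := k) three_ne_zero
      rwa [Nat.cast_ofNat] at this
    rw [hR]
    have hex := existsUniqueRep27_natPow hp h1 hk
    have hspec : ∀ a b : ℤ, IsRep27 p ((p : ℝ) ^ k) a b → _ := fun a b hab =>
      have hab := (isRep27_natPow_iff hp).mp hab
      gpGraph_three_hasSpec_cube hp h1 hF hq5 h3 hab.1 hab.2.1 hab.2.2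
    refine ⟨hex, hspec, ?_⟩
    obtain ⟨a, b, hab, -⟩ := hex
    obtain ⟨i0, i1, i2⟩ := exists_intCast_cubic_values h1 ((isRep27_natPow_iff hp).mp hab).1
      hab.2.1
    intro l hl
    rw [(hspec a b hab).2] at hl
    simp only [List.map_cons, List.map_nil, List.sum_cons, List.sum_nil, add_zero,
      Multiset.mem_add, Multiset.mem_replicate] at hl
    rcases hl with ⟨-, rfl⟩ | ⟨-, rfl⟩ | ⟨-, rfl⟩ | ⟨-, rfl⟩
    · exact ⟨((p ^ (3 * k) - 1) / 3 : ℕ), (Int.cast_natCast _).symm⟩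
    · exact i0
    · exact i1
    · exact i2
  · intro h1 hm
    have h1 : p % 3 = 1 := h1
    have hm0 : m ≠ 0 := by rintro rfl; simp at hm
    have hq0 : p ^ m ≠ 0 := by omega
    rw [show ((p ^ m : ℕ) : ℝ) = (p : ℝ) ^ m by push_cast; rfl]
    have hex := existsUniqueRep27_natPow hp h1 hm0
    refine ⟨hex, ?_, ?_⟩
    · intro a b hab s c d hs hc hd
      obtain ⟨hab, ha, hpa⟩ := (isRep27_natPow_iff hp).mp hab
      have hb := right_ne_zero_of_sq_add_twentySeven_mul_sq hp hm0 hab hpa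
      constructor
      · intro j
        rw [← zeta3]
        refine im_ne_zero_of_two_mul_cube_eq hq0 hb hs (A := -a) ?_
        have hj : (zeta3 ^ j) ^ 3 = 1 := by rw [← pow_mul, mul_comm, pow_mul, zeta3_cube, one_pow]
        rw [mul_pow, hj, mul_pow, hc, hd]
        push_cast
        ring
      -- Cubing `-c d` turns `-a + s b` into `a - s b`, so the root of `-27` to use is `-s`.
      · have hz : 2 * (-(c * d)) ^ 3 = (p : ℂ) ^ m * (a + -s * b) := by
          rw [neg_pow, mul_pow, hc, hd]
          push_cast
          ring
        have := gpGraph_three_hasSpec hp h1 hF hq5 h3 hab ha hpa (by rw [neg_sq, hs]) hz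
        rwa [cardanoRoot_eq, cardanoRoot_eq, cardanoRoot_eq, pow_zero, one_mul, pow_one]
    · intro l hl hln
      obtain ⟨a, b, hab, -⟩ := hex
      obtain ⟨hab, ha, hpa⟩ := (isRep27_natPow_iff hp).mp hab
      have hs : (3 * (2 * zeta3 + 1)) ^ 2 = -27 := by linear_combination 36 * zeta3_sq
      -- Any cube root will do, since the spectrum does not depend on the choice.
      obtain ⟨z, hz⟩ := IsAlgClosed.exists_pow_nat_eq
        ((p : ℂ) ^ m * (a + 3 * (2 * zeta3 + 1) * b) / 2) three_pos
      have hz : 2 * z ^ 3 = (p : ℂ) ^ m * (a + 3 * (2 * zeta3 + 1) * b) := by rw [hz]; ring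
      rw [(gpGraph_three_hasSpec hp h1 hF hq5 h3 hab ha hpa hs hz).2] at hl
      simp only [List.map_cons, List.map_nil, List.sum_cons, List.sum_nil, add_zero,
        Multiset.mem_add, Multiset.mem_replicate] at hl
      rcases hl with ⟨-, rfl⟩ | ⟨-, rfl⟩ | ⟨-, rfl⟩ | ⟨-, rfl⟩
      · exact absurd rfl hln
      · exact exists_irrational_cubicEigenvalue_eq hp hm hab hpa hs hz
      · exact exists_irrational_cubicEigenvalue_eq hp hm hab hpa hs
          (by rw [mul_pow, zeta3_cube, one_mul]; exact hz)
      · exact exists_irrational_cubicEigenvalue_eq hp hm hab hpa hs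
          (by linear_combination hz + 2 * (zeta3 ^ 3 + 1) * z ^ 3 * zeta3_cube)
  · intro h2 hm
    have h2 : p % 3 = 2 := h2
    obtain ⟨h, rfl⟩ : ∃ h, m = h * 2 := by
      obtain ⟨h, rfl⟩ := hm
      exact ⟨h, by ring⟩
    rw [pow_mul] at hF hq5 h3 ⊢
    have hp3 : (p : ℤ) ≡ -1 [ZMOD 3] := by rw [Int.ModEq]; omega
    have hsqrt : Real.sqrt (((p ^ h) ^ 2 : ℕ) : ℝ) = (p : ℝ) ^ h := by
      push_cast
      exact Real.sqrt_sq (by positivity)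
    have hint : ∀ e : ℤ, e = 1 ∨ e = -1 → e * p ^ h ≡ 2 [ZMOD 3] →
        ∀ l ∈ (gpGraph 3 F).spec, ∃ z : ℤ, l = z := by
      intro e he her l hl
      rw [(gpGraph_three_spec_of_semiprimitive hp h2 hF hq5 h3 he her).1] at hl
      obtain ⟨t, ht⟩ := her.symm.dvd
      have ht' : (e * (p : ℂ) ^ h - 2) = 3 * t := by exact_mod_cast ht
      simp only [Multiset.mem_cons, Multiset.mem_add, Multiset.mem_replicate] at hl
      rcases hl with rfl | ⟨-, rfl⟩ | ⟨-, rfl⟩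
      · exact ⟨(((p ^ h) ^ 2 - 1) / 3 : ℕ), (Int.cast_natCast _).symm⟩
      -- Both integers come from writing `e p ^ h = 3 t + 2`.
      · exact ⟨2 * t + 1, by push_cast; linear_combination 2 * ht' / 3⟩
      · exact ⟨-t - 1, by push_cast; linear_combination -ht' / 3⟩
    -- Since `p ^ h ≡ (-1) ^ h (mod 3)`, the sign `e` is `-1` for even `h` and `1` for odd `h`, that
    -- is, for `m ≡ 0` and `m ≡ 2 (mod 4)`.
    have heven : h % 2 = 0 → ((-1 : ℤ) * p ^ h ≡ 2 [ZMOD 3]) := by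
      intro hh
      have := hp3.pow h
      rw [(Nat.even_iff.mpr hh).neg_one_pow] at this
      exact (this.mul_left (-1)).trans (by decide)
    have hodd : h % 2 = 1 → ((1 : ℤ) * p ^ h ≡ 2 [ZMOD 3]) := by
      intro hh
      have := hp3.pow h
      rw [(Nat.odd_iff.mpr hh).neg_one_pow] at this
      exact (this.mul_left 1).trans (by decide)
    rw [hsqrt]
    refine ⟨?_, ?_, ?_⟩
    · intro h4
      have h4 : h * 2 % 4 = 0 := h4
      obtain ⟨hs, n1, n2, n3⟩ := gpGraph_three_spec_of_semiprimitive hp h2 hF hq5 h3 (.inr rfl)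
        (heven (by omega))
      have v1 : ((((p : ℝ) ^ h - 1) / 3 : ℝ) : ℂ) =
          (-(((-1 : ℤ) : ℂ) * (p : ℂ) ^ h) - 1) / 3 := by push_cast; ring
      have v2 : (((-2 * (p : ℝ) ^ h - 1) / 3 : ℝ) : ℂ) =
          (2 * (((-1 : ℤ) : ℂ) * (p : ℂ) ^ h) - 1) / 3 := by push_cast; ring
      rw [v1, v2]
      refine ⟨?_, ?_⟩
      · simp only [List.map_cons, List.map_nil, List.nodup_cons, List.mem_cons, List.not_mem_nil,
          or_false, not_or]
        exact ⟨⟨n2, n1⟩, n3.symm, not_false, List.nodup_nil⟩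
      · rw [hs, add_comm (Multiset.replicate _ _)]
        simp only [List.map_cons, List.map_nil, List.sum_cons, List.sum_nil, add_zero,
          Multiset.replicate_one, Multiset.singleton_add]
    · intro h4
      have h4 : h * 2 % 4 = 2 := h4
      obtain ⟨hs, n1, n2, n3⟩ := gpGraph_three_spec_of_semiprimitive hp h2 hF hq5 h3 (.inl rfl)
        (hodd (by omega))
      have v1 : (((2 * (p : ℝ) ^ h - 1) / 3 : ℝ) : ℂ) =
          (2 * (((1 : ℤ) : ℂ) * (p : ℂ) ^ h) - 1) / 3 := by push_cast; ring
      have v2 : (((-(p : ℝ) ^ h - 1) / 3 : ℝ) : ℂ) =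
          (-(((1 : ℤ) : ℂ) * (p : ℂ) ^ h) - 1) / 3 := by push_cast; ring
      rw [v1, v2]
      refine ⟨?_, ?_⟩
      · simp only [List.map_cons, List.map_nil, List.nodup_cons, List.mem_cons, List.not_mem_nil,
          or_false, not_or]
        exact ⟨⟨n1, n2⟩, n3, not_false, List.nodup_nil⟩
      · rw [hs]
        simp only [List.map_cons, List.map_nil, List.sum_cons, List.sum_nil, add_zero,
          Multiset.replicate_one, Multiset.singleton_add]
    · rcases Nat.mod_two_eq_zero_or_one h with hh | hh
      · exact hint (-1) (.inr rfl) (heven hh)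
      · exact hint 1 (.inl rfl) (hodd hh)
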